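/- Let $k\ge 2$. For each design $i\in\{1,\dots,k\}$ let $\mu_i\in\mathbb R$ and $\sigma_i>0$, and suppose that $i^*=\arg\max_i\mu_i$ is unique. Let $X_{i,l}$ ($1\le i\le k$, $l\ge 1$) be (pairwise) independent random variables with $X_{i,l}\sim\mathcal N(\mu_i,\sigma_i^2)$. Let $\pi^0\ge 0$ be a prior density on $\mathbb R^k\times\mathbb R_+^k$ (means $\boldsymbol\phi$, variances $\boldsymbol\psi$) that integrates to $1$, is bounded above, and satisfies $\pi^0\ge\underline c$ for some constant $\underline c>0$ on the box $$H_w=[\mu_{\min}-\bar\epsilon,\ \mu_{\max}+\bar\epsilon]^k\times[\sigma^2_{\min}-\bar\epsilon,\ \sigma^2_{\max}+\bar\epsilon+(\mu_{\max}-\mu_{\min}+2\bar\epsilon)^2]^k$$ for some $0<\bar\epsilon<\sigma^2_{\min}/2$, where $\mu_{\min},\mu_{\max},\sigma^2_{\min},\sigma^2_{\max}$ are the smallest and largest of the $\mu_i$ and of the $\sigma_i^2$. For each total budget $n$ let $N_i=N_i(n)$ be deterministic sample sizes with $\sum_i N_i=n$, $N_i\to\infty$ and $N_i/n\to\alpha_i$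 as $n\to\infty$ for every $i$. Let $$\pi^n(\boldsymbol\phi,\boldsymbol\psi)\propto\pi^0(\boldsymbol\phi,\boldsymbol\psi)\prod_{i=1}^k\prod_{l=1}^{N_i}f(X_{i,l}\mid\phi_i,\psi_i)$$ be the posterior density, where $f(\cdot\mid\phi,\psi)$ is the $\mathcal N(\phi,\psi)$ density. Let $\hat\mu_i^n$ be the posterior mean of $\phi_i$, let $i^{*,n}\in\arg\max_i\hat\mu^n_i$ (ties broken arbitrarily), and let $PCS^n_B$ be the probability under $\pi^n$ that $\phi_{i^{*,n}}>\phi_i$ for all $i\ne i^{*,n}$. Then, almost surely, for all sufficiently large $n$ the posterior is well defined with finite means and $PCS_B^n<1$, and $$-\lim_{n\to\infty}\frac1n\log\left(1-PCS^n_B\right)=\min_{i\ne i^*}\mathcal V_i(\alpha_i,\alpha_{i^*}),$$ where $$\mathcal V_i(\alpha_i,\alpha_{i^*})=\min_{\phi\in\mathbb R}\left[\frac{\alpha_i}{2}\log\left(1+\frac{(\mu_i-\phi)^2}{\sigma_i^2}\right)+\frac{\alpha_{i^*}}{2}\log\left(1+\frac{(\mu_{i^*}-\phi)^2}{\sigma_{i^*}^2}\right)\right]$$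 and the minimum over $\phi$ is attained. -/

import Mathlib

open MeasureTheory ProbabilityTheory Filter Topology Set

/-- Parameter points `(φ, ψ)`: means `p.1` and variances `p.2` of the `k` designs. -/
abbrev Param (k : ℕ) : Type := (Fin k → ℝ) × (Fin k → ℝ)

/-- The parameter space `ℝ^k × ℝ_+^k`, where all variances are positive. -/
def paramSpace (k : ℕ) : Set (Param k) := {p | ∀ i, 0 < p.2 i}

/-- The box `H_w` around the true values, with margin `ε`, on which the prior density has to be
bounded away from zero. -/
def priorBox {k : ℕ} (μ σ : Fin k → ℝ) (ε : ℝ) : Set (Param k) :=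
  {p | ∀ i, p.1 i ∈ Icc ((⨅ j, μ j) - ε) ((⨆ j, μ j) + ε) ∧
    p.2 i ∈ Icc ((⨅ j, σ j ^ 2) - ε)
      ((⨆ j, σ j ^ 2) + ε + ((⨆ j, μ j) - (⨅ j, μ j) + 2 * ε) ^ 2)}

/-- The conditions on the joint prior density `π₀` of means and variances, the true values being
`μ i` and `σ i ^ 2`. (Integrability on `paramSpace k` follows from `integral_eq_one`.) -/
structure IsAdmissiblePrior {k : ℕ} (μ σ : Fin k → ℝ) (π₀ : Param k → ℝ) : Prop where
  nonneg : ∀ p ∈ paramSpace k, 0 ≤ π₀ p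
  bounded_above : ∃ C > 0, ∀ p ∈ paramSpace k, π₀ p ≤ C
  integral_eq_one : ∫ p in paramSpace k, π₀ p = 1
  bounded_below : ∃ ε > 0, ε < (⨅ j, σ j ^ 2) / 2 ∧ ∃ c > 0, ∀ p ∈ priorBox μ σ ε, c ≤ π₀ p

/-- The likelihood of the first `N i` observations `x i 0, …, x i (N i - 1)` of every design `i`
under the normal distributions with means `p.1 i` and variances `p.2 i`. -/
noncomputable def likelihood {k : ℕ} (x : Fin k → ℕ → ℝ) (N : Fin k → ℕ) (p : Param k) : ℝ :=
  ∏ i, ∏ l ∈ Finset.range (N i), gaussianPDFReal (p.1 i) (p.2 i).toNNReal (x i l)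

/-- The normalizing constant in Bayes' rule. -/
noncomputable def evidence {k : ℕ} (π₀ : Param k → ℝ) (x : Fin k → ℕ → ℝ) (N : Fin k → ℕ) : ℝ :=
  ∫ p in paramSpace k, π₀ p * likelihood x N p

/-- The posterior density. -/
noncomputable def posterior {k : ℕ} (π₀ : Param k → ℝ) (x : Fin k → ℕ → ℝ) (N : Fin k → ℕ)
    (p : Param k) : ℝ :=
  π₀ p * likelihood x N p / evidence π₀ x N

/-- The posterior mean of the value of design `i`. -/
noncomputable def posteriorMean {k : ℕ} (π₀ : Param k → ℝ) (x : Fin k → ℕ → ℝ) (N : Fin k → ℕ)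
    (i : Fin k) : ℝ :=
  ∫ p in paramSpace k, p.1 i * posterior π₀ x N p

/-- The posterior is well defined and has finite means. -/
def PosteriorWellDefined {k : ℕ} (π₀ : Param k → ℝ) (x : Fin k → ℕ → ℝ) (N : Fin k → ℕ) : Prop :=
  IntegrableOn (fun p => π₀ p * likelihood x N p) (paramSpace k) ∧
    0 < evidence π₀ x N ∧
    ∀ i, IntegrableOn (fun p => p.1 i * posterior π₀ x N p) (paramSpace k)

/-- The Bayesian probability of correct selection when design `b` is selected: the posterior
probability that `b` is strictly better than every other design. -/
noncomputable def bayesPCS {k : ℕ} (π₀ : Param k → ℝ) (x : Fin k → ℕ → ℝ) (N : Fin k → ℕ)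
    (b : Fin k) : ℝ :=
  ∫ p in paramSpace k ∩ {p | ∀ i, i ≠ b → p.1 i < p.1 b}, posterior π₀ x N p

/-- The function of `φ` that is minimized in the rate for the pair `(i, b)`. -/
noncomputable def rateObjective {k : ℕ} (μ σ α : Fin k → ℝ) (b i : Fin k) (φ : ℝ) : ℝ :=
  α i / 2 * Real.log (1 + (μ i - φ) ^ 2 / σ i ^ 2) +
    α b / 2 * Real.log (1 + (μ b - φ) ^ 2 / σ b ^ 2)

/-- The pairwise rate `V_i(α_i, α_b)`. -/
noncomputable def pairRate {k : ℕ} (μ σ α : Fin k → ℝ) (b i : Fin k) : ℝ :=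
  ⨅ φ : ℝ, rateObjective μ σ α b i φ

/-! The argument is Laplace's method, carried out pathwise. For a normal sample with mean `m` and
biased variance `s > 0`, the likelihood at `(φ, ψ)` is its maximum times `exp (-N * gaussLoss m s
(φ, ψ))`, and the loss is the Kullback-Leibler divergence from `N(m, s)` to `N(φ, ψ)`. The maxima
cancel in Bayes' rule, and by the strong law `(m, s)` tends to the true `(μ, σ²)`. What remains is
deterministic: the posterior mass of an event should decay like `exp (-n * inf ∑ α_j * loss_j)`, the
infimum being over the event.

For fixed `φ` the loss is least at `ψ = s + (m - φ)²`, with value `1/2 * log (1 + (m - φ)² / s)`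
(`half_log_le_gaussLoss`, `gaussLoss_profile`); the upper variance bound of the prior box makes room
for these points. If design `i` is at least as good as the true best `b`, clamping moves both means
to a common value between the sample means at no extra cost (`exists_mem_Icc_abs_sub_le`), and the
other designs can sit at their true parameters for free. This gives the pairwise rate.

The parameter space is not compact, so eight powers of each likelihood factor are set aside: `(1 +
|φ|) * exp (-8 * loss)` has an integral bounded uniformly for `(m, s)` near the truth
(`exists_one_add_abs_mul_exp_le`), and the other `N - 8` powers carry the exponential rate. Lower
bounds come from small boxes on which the prior is at least a constant.

The selected design has to be identified as well. Posterior means are consistent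
(`tendsto_relLikelihood_mean`), hence the selected design is eventually the true best one. -/

/-! ### The loss of a single design -/

/-- The open half-plane of pairs (mean, variance). -/
def halfPlane : Set (ℝ × ℝ) := {z | 0 < z.2}

/-- The loss in average log-likelihood at the parameters `z = (φ, ψ)`, relative to the maximum
likelihood parameters `(m, s)`, of a normal sample with mean `m` and variance `s`. -/
noncomputable def gaussLoss (m s : ℝ) (z : ℝ × ℝ) : ℝ :=
  1 / 2 * Real.log (z.2 / s) + (s + (m - z.1) ^ 2) / (2 * z.2) - 1 / 2

theorem measurableSet_halfPlane : MeasurableSet halfPlane :=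
  measurableSet_lt measurable_const measurable_snd

theorem measurable_gaussLoss (m s : ℝ) : Measurable (gaussLoss m s) := by
  unfold gaussLoss
  fun_prop

/-- This is `log t ≤ t - 1` at `t = (s + (m - φ)²) / ψ`: the variance is profiled out. -/
theorem half_log_le_gaussLoss {m s : ℝ} {z : ℝ × ℝ} (hs : 0 < s) (hz : z ∈ halfPlane) :
    1 / 2 * Real.log (1 + (m - z.1) ^ 2 / s) ≤ gaussLoss m s z := by
  have hz' : 0 < z.2 := hz
  have ht : 0 < s + (m - z.1) ^ 2 := by positivity
  have h1 : Real.log ((s + (m - z.1) ^ 2) / z.2) ≤ (s + (m - z.1) ^ 2) / z.2 - 1 :=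
    Real.log_le_sub_one_of_pos (by positivity)
  rw [Real.log_div ht.ne' hz'.ne'] at h1
  have h2 : 1 + (m - z.1) ^ 2 / s = (s + (m - z.1) ^ 2) / s := by field_simp
  have h3 : (s + (m - z.1) ^ 2) / (2 * z.2) = 1 / 2 * ((s + (m - z.1) ^ 2) / z.2) := by
    field_simp
  rw [gaussLoss, h2, h3, Real.log_div ht.ne' hs.ne', Real.log_div hz'.ne' hs.ne']
  linarith

theorem gaussLoss_nonneg {m s : ℝ} {z : ℝ × ℝ} (hs : 0 < s) (hz : z ∈ halfPlane) :
    0 ≤ gaussLoss m s z := by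
  refine le_trans ?_ (half_log_le_gaussLoss hs hz)
  have : 0 ≤ Real.log (1 + (m - z.1) ^ 2 / s) := by
    apply Real.log_nonneg
    have : 0 ≤ (m - z.1) ^ 2 / s := by positivity
    linarith
  linarith

/-- Complements the profile bound, which is blind to `ψ`. Dropping the mean term and putting `r =
√(s / ψ)`, the loss is at least `r² / 2 - 1 / 2 - log r`, and `log r ≤ r - 1`. -/
theorem sqrt_sub_one_sq_le_gaussLoss {m s : ℝ} {z : ℝ × ℝ} (hs : 0 < s) (hz : z ∈ halfPlane) :
    1 / 2 * (√(s / z.2) - 1) ^ 2 ≤ gaussLoss m s z := by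
  have hz' : 0 < z.2 := hz
  have hr : 0 < s / z.2 := by positivity
  have h1 : Real.log √(s / z.2) ≤ √(s / z.2) - 1 :=
    Real.log_le_sub_one_of_pos (Real.sqrt_pos.2 hr)
  rw [Real.log_sqrt hr.le] at h1
  have h2 : Real.log (z.2 / s) = - Real.log (s / z.2) := by
    rw [← Real.log_inv, inv_div]
  have h3 : (s + (m - z.1) ^ 2) / (2 * z.2) = 1 / 2 * (s / z.2) + (m - z.1) ^ 2 / (2 * z.2) := by
    field_simp
  have h4 : 0 ≤ (m - z.1) ^ 2 / (2 * z.2) := by positivity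
  rw [gaussLoss, h2, h3]
  nlinarith [Real.sq_sqrt hr.le]

theorem gaussLoss_profile {m s : ℝ} (hs : 0 < s) (φ : ℝ) :
    gaussLoss m s (φ, s + (m - φ) ^ 2) = 1 / 2 * Real.log (1 + (m - φ) ^ 2 / s) := by
  have ht : 0 < s + (m - φ) ^ 2 := by positivity
  have h2 : 1 + (m - φ) ^ 2 / s = (s + (m - φ) ^ 2) / s := by field_simp
  rw [gaussLoss, h2]
  simp only
  field_simp
  ring

theorem continuousAt_gaussLoss {q : (ℝ × ℝ) × (ℝ × ℝ)} (h1 : 0 < q.1.2) (h2 : 0 < q.2.2) :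
    ContinuousAt (fun q : (ℝ × ℝ) × (ℝ × ℝ) => gaussLoss q.1.1 q.1.2 q.2) q := by
  unfold gaussLoss
  have : q.2.2 / q.1.2 ≠ 0 := by positivity
  have h3 : 2 * q.2.2 ≠ 0 := by positivity
  have h4 : q.1.2 ≠ 0 := h1.ne'
  fun_prop (disch := assumption)

theorem eventually_gaussLoss_le {μ v : ℝ} {z₀ : ℝ × ℝ} (hv : 0 < v) (hz₀ : z₀ ∈ halfPlane)
    {ε : ℝ} (hε : 0 < ε) :
    ∃ δ > 0, ∀ᶠ θ in 𝓝 (μ, v), ∀ z, dist z z₀ ≤ δ →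
      gaussLoss θ.1 θ.2 z ≤ gaussLoss μ v z₀ + ε := by
  have hc := continuousAt_gaussLoss (q := ((μ, v), z₀)) hv hz₀
  have h := hc.eventually (gt_mem_nhds (lt_add_of_pos_right _ hε))
  rw [nhds_prod_eq, eventually_prod_iff] at h
  obtain ⟨p, hp, q, hq, hpq⟩ := h
  obtain ⟨δ, hδ, hδq⟩ := Metric.eventually_nhds_iff.1 hq
  refine ⟨δ / 2, by positivity, ?_⟩
  filter_upwards [hp] with θ hθ z hz
  exact (hpq hθ (hδq (lt_of_le_of_lt hz (by linarith)))).le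

-- Near the truth, all losses grow fast enough for one integrable function, a multiple of a product
-- of two Cauchy densities, to dominate every envelope.
set_option maxHeartbeats 800000 in
theorem exists_one_add_abs_mul_exp_le (μ : ℝ) {v : ℝ} (hv : 0 < v) :
    ∃ c > 0, ∀ᶠ θ : ℝ × ℝ in 𝓝 (μ, v), ∀ z ∈ halfPlane,
      (1 + |z.1|) * Real.exp (-(8 * gaussLoss θ.1 θ.2 z)) ≤
        c * ((1 + z.1 ^ 2)⁻¹ * (1 + z.2 ^ 2)⁻¹) := by
  set M := |μ| + 1
  set B := 1 + 2 * M ^ 2 + 4 * v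
  set A := 1 + Real.exp 2 * (2 * v) ^ 2
  have hA : 0 < A := by positivity
  have hB : 0 < B := by positivity
  refine ⟨2 * B ^ 2 * A, by positivity, ?_⟩
  have e1 : ∀ᶠ θ : ℝ × ℝ in 𝓝 (μ, v), |θ.1| < M :=
    (continuous_fst.abs.continuousAt (x := (μ, v))).eventually
      (gt_mem_nhds (by simp [M]))
  have e2 : ∀ᶠ θ : ℝ × ℝ in 𝓝 (μ, v), θ.2 < 2 * v :=
    (continuous_snd.continuousAt (x := (μ, v))).eventually (gt_mem_nhds (by simp; linarith))
  have e3 : ∀ᶠ θ : ℝ × ℝ in 𝓝 (μ, v), 0 < θ.2 :=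
    (continuous_snd.continuousAt (x := (μ, v))).eventually (lt_mem_nhds hv)
  filter_upwards [e1, e2, e3] with θ h1 h2 h3 z hz
  obtain ⟨m, s⟩ := θ
  obtain ⟨φ, ψ⟩ := z
  simp only at h1 h2 h3 ⊢
  have hψ : 0 < ψ := hz
  set L := gaussLoss m s (φ, ψ) with hL
  have hL0 : 0 ≤ L := gaussLoss_nonneg h3 hz
  have hm2 : m ^ 2 ≤ M ^ 2 := by
    rw [← sq_abs m]; gcongr
  -- Four powers give decay `(1 + φ²)⁻²`, one factor of which absorbs the weight `1 + |φ|`; the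
  -- other four give decay `(1 + ψ²)⁻¹`.
  have hexp : Real.exp (-(8 * L)) = Real.exp (-(4 * L)) * Real.exp (-(4 * L)) := by
    rw [← Real.exp_add]; ring_nf
  have b1 : Real.exp (-(4 * L)) * (1 + φ ^ 2) ^ 2 ≤ B ^ 2 := by
    set t := 1 + (m - φ) ^ 2 / s with ht
    have htpos : 0 < t := by positivity
    have hl : 1 / 2 * Real.log t ≤ L := half_log_le_gaussLoss h3 hz
    have hx : Real.exp (-(4 * L)) ≤ (t ^ 2)⁻¹ := by
      calc Real.exp (-(4 * L)) ≤ Real.exp (-(2 * Real.log t)) :=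
            Real.exp_le_exp.2 (by linarith)
        _ = (t ^ 2)⁻¹ := by
          rw [Real.exp_neg, two_mul, Real.exp_add, Real.exp_log htpos, sq]
    have hq : (m - φ) ^ 2 ≤ 2 * v * (t - 1) := by
      have : (m - φ) ^ 2 = s * (t - 1) := by rw [ht]; field_simp; ring
      have ht1 : 0 ≤ t - 1 := by
        rw [ht]; have : 0 ≤ (m - φ) ^ 2 / s := by positivity
        linarith
      nlinarith
    have ht1 : 1 ≤ t := by
      have : 0 ≤ (m - φ) ^ 2 / s := by positivity
      linarith
    have hφ : 1 + φ ^ 2 ≤ B * t := by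
      have h5 : φ ^ 2 ≤ 2 * m ^ 2 + 2 * (m - φ) ^ 2 := by nlinarith [sq_nonneg (2 * m - φ)]
      have h6 : 0 ≤ (1 + 2 * M ^ 2) * (t - 1) := mul_nonneg (by positivity) (by linarith)
      have : B * t = (1 + 2 * M ^ 2) + (1 + 2 * M ^ 2) * (t - 1) + 4 * v * (t - 1) + 4 * v := by
        simp only [B]; ring
      nlinarith
    calc Real.exp (-(4 * L)) * (1 + φ ^ 2) ^ 2 ≤ (t ^ 2)⁻¹ * (B * t) ^ 2 := by gcongr
      _ = B ^ 2 := by field_simp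
  have b2 : Real.exp (-(4 * L)) * (1 + ψ ^ 2) ≤ A := by
    have h4 : Real.exp (-(4 * L)) ≤ 1 := Real.exp_le_one_iff.2 (by linarith)
    have h5 : Real.exp (-(4 * L)) ≤ Real.exp 2 * (s / ψ) ^ 2 := by
      have h6 : 1 / 2 * Real.log (ψ / s) - 1 / 2 ≤ L := by
        rw [hL, gaussLoss]
        have : 0 ≤ (s + (m - φ) ^ 2) / (2 * ψ) := by positivity
        simp only; linarith
      have h7 : Real.log (s / ψ) = - Real.log (ψ / s) := by rw [← Real.log_inv, inv_div]
      calc Real.exp (-(4 * L)) ≤ Real.exp (2 + 2 * Real.log (s / ψ)) :=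
            Real.exp_le_exp.2 (by rw [h7]; linarith)
        _ = _ := by
          rw [Real.exp_add, two_mul (Real.log _), Real.exp_add, Real.exp_log (by positivity)]; ring
    have h8 : Real.exp (-(4 * L)) * ψ ^ 2 ≤ Real.exp 2 * (2 * v) ^ 2 := by
      calc _ ≤ Real.exp 2 * (s / ψ) ^ 2 * ψ ^ 2 := by gcongr
        _ = Real.exp 2 * s ^ 2 := by field_simp
        _ ≤ _ := by gcongr
    simp only [A]; linarith
  have b3 : 1 + |φ| ≤ 2 * (1 + φ ^ 2) := by
    nlinarith [sq_nonneg (|φ| - 1), sq_abs φ, abs_nonneg φ]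
  have hP : 0 < 1 + φ ^ 2 := by positivity
  have hS : 0 < 1 + ψ ^ 2 := by positivity
  rw [hexp, ← mul_inv, ← div_eq_mul_inv, le_div_iff₀ (by positivity)]
  calc (1 + |φ|) * (Real.exp (-(4 * L)) * Real.exp (-(4 * L))) * ((1 + φ ^ 2) * (1 + ψ ^ 2))
      ≤ (2 * (1 + φ ^ 2)) * (Real.exp (-(4 * L)) * Real.exp (-(4 * L))) *
        ((1 + φ ^ 2) * (1 + ψ ^ 2)) := by gcongr
    _ = 2 * (Real.exp (-(4 * L)) * (1 + φ ^ 2) ^ 2) * (Real.exp (-(4 * L)) * (1 + ψ ^ 2)) := by ring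
    _ ≤ 2 * B ^ 2 * A := by gcongr

/-- The gap `η` must not depend on `(m, s)`. A wrong mean is detected by the profile bound, a wrong
variance by the square root bound. -/
theorem exists_le_gaussLoss_of_not_near (μ : ℝ) {v δ : ℝ} (hv : 0 < v) (hδ : 0 < δ) :
    ∃ η > 0, ∀ᶠ θ : ℝ × ℝ in 𝓝 (μ, v), ∀ z ∈ halfPlane,
      ¬ (|z.1 - μ| ≤ δ ∧ |z.2 - v| ≤ δ) → η ≤ gaussLoss θ.1 θ.2 z := by
  -- `a` bounds `√(s / ψ)` from above when `ψ > v + δ`, and `b` bounds it from below when `ψ < v -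
  -- δ`, for `s` within `min δ v / 2` of `v`. The fraction 2/3 lies between 1/2 and 1, so `b > 1`
  -- and its denominator is positive even if `δ ≥ v`.
  set a := √((v + δ / 2) / (v + δ)) with ha
  set b := √((v - min δ v / 2) / (v - min δ v / 3 * 2)) with hb
  have hmn : 0 < min δ v := lt_min hδ hv
  have hmnv : min δ v ≤ v := min_le_right _ _
  have hmnd : min δ v ≤ δ := min_le_left _ _
  have ha1 : a < 1 := by
    rw [ha, Real.sqrt_lt' one_pos, one_pow, div_lt_one (by positivity)]; linarith
  have hb1 : 1 < b := by
    rw [hb, Real.lt_sqrt zero_le_one, one_pow, one_lt_div (by linarith)]; linarith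
  set η₁ := 1 / 2 * Real.log (1 + (δ / 2) ^ 2 / (2 * v)) with hη₁
  have hη₁p : 0 < η₁ := by
    have : 0 < Real.log (1 + (δ / 2) ^ 2 / (2 * v)) := Real.log_pos (by
      have : 0 < (δ / 2) ^ 2 / (2 * v) := by positivity
      linarith)
    positivity
  have hη₂p : 0 < 1 / 2 * (1 - a) ^ 2 := by
    have : 0 < 1 - a := by linarith
    positivity
  have hη₃p : 0 < 1 / 2 * (b - 1) ^ 2 := by
    have : 0 < b - 1 := by linarith
    positivity
  refine ⟨min η₁ (min (1 / 2 * (1 - a) ^ 2) (1 / 2 * (b - 1) ^ 2)),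
    lt_min hη₁p (lt_min hη₂p hη₃p), ?_⟩
  have e1 : ∀ᶠ θ : ℝ × ℝ in 𝓝 (μ, v), |θ.1 - μ| < δ / 2 :=
    ((continuous_fst.sub continuous_const).abs.continuousAt (x := (μ, v))).eventually
      (gt_mem_nhds (by simpa using hδ))
  have e2 : ∀ᶠ θ : ℝ × ℝ in 𝓝 (μ, v), |θ.2 - v| < min δ v / 2 :=
    ((continuous_snd.sub continuous_const).abs.continuousAt (x := (μ, v))).eventually
      (gt_mem_nhds (by simp [hδ, hv]))
  filter_upwards [e1, e2] with θ h1 h2 z hz hnot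
  obtain ⟨m, s⟩ := θ
  obtain ⟨φ, ψ⟩ := z
  have hψ : 0 < ψ := hz
  simp only at h1 h2 hnot ⊢
  rw [abs_lt] at h1 h2
  have hs : 0 < s := by linarith
  by_cases hφ : |φ - μ| ≤ δ
  · have hψ' : δ < |ψ - v| := by
      by_contra! h
      exact hnot ⟨hφ, h⟩
    have hl := sqrt_sub_one_sq_le_gaussLoss (m := m) hs hz
    refine le_trans ?_ hl
    simp only
    rcases lt_abs.1 hψ' with h | h
    · refine (min_le_right _ _).trans ((min_le_left _ _).trans ?_)
      have : √(s / ψ) ≤ a := by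
        apply Real.sqrt_le_sqrt
        apply div_le_div₀ <;> linarith
      nlinarith
    · refine (min_le_right _ _).trans ((min_le_right _ _).trans ?_)
      have : b ≤ √(s / ψ) := by
        apply Real.sqrt_le_sqrt
        apply div_le_div₀ <;> linarith
      nlinarith
  · push Not at hφ
    refine (min_le_left _ _).trans (le_trans ?_ (half_log_le_gaussLoss hs hz))
    have : δ / 2 ≤ |m - φ| := by
      rw [le_abs]
      rcases lt_abs.1 hφ with h | h
      · right; linarith
      · left; linarith
    rw [hη₁]
    have hsq : (δ / 2) ^ 2 ≤ (m - φ) ^ 2 := by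
      rw [← sq_abs (m - φ)]
      exact pow_le_pow_left₀ (by positivity) this 2
    gcongr
    linarith

/-! ### Product boxes and Fubini -/

/-- The set of parameters whose `j`-th pair (mean, variance) lies in `A j` for every `j`. -/
def boxSet {k : ℕ} (A : Fin k → Set (ℝ × ℝ)) : Set (Param k) :=
  {p | ∀ j, (p.1 j, p.2 j) ∈ A j}

theorem paramSpace_eq_boxSet (k : ℕ) : paramSpace k = boxSet fun _ => halfPlane := rfl

theorem boxSet_mono {k : ℕ} {A B : Fin k → Set (ℝ × ℝ)} (h : ∀ j, A j ⊆ B j) :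
    boxSet A ⊆ boxSet B := fun _ hp j => h j (hp j)

theorem preimage_boxSet {k : ℕ} (A : Fin k → Set (ℝ × ℝ)) :
    MeasurableEquiv.arrowProdEquivProdArrow ℝ ℝ (Fin k) ⁻¹' boxSet A = univ.pi A := by
  ext g
  simp [boxSet, MeasurableEquiv.arrowProdEquivProdArrow, Equiv.arrowProdEquivProdArrow]

theorem measurableSet_boxSet {k : ℕ} {A : Fin k → Set (ℝ × ℝ)} (hA : ∀ j, MeasurableSet (A j)) :
    MeasurableSet (boxSet A) := by
  rw [← (MeasurableEquiv.arrowProdEquivProdArrow ℝ ℝ (Fin k)).measurableSet_preimage,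
    preimage_boxSet]
  exact MeasurableSet.univ_pi hA

theorem measurableSet_paramSpace (k : ℕ) : MeasurableSet (paramSpace k) :=
  measurableSet_boxSet fun _ => measurableSet_halfPlane

/-- Fubini, after the measure-preserving regrouping of (all means, all variances) into one pair per
design. -/
theorem setIntegral_boxSet {k : ℕ} (A : Fin k → Set (ℝ × ℝ)) (f : Fin k → ℝ × ℝ → ℝ) :
    ∫ p in boxSet A, ∏ j, f j (p.1 j, p.2 j) = ∏ j, ∫ z in A j, f j z := by
  have h := (volume_measurePreserving_arrowProdEquivProdArrow ℝ ℝ (Fin k)).setIntegral_preimage_emb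
    (MeasurableEquiv.measurableEmbedding _) (fun p : Param k => ∏ j, f j (p.1 j, p.2 j)) (boxSet A)
  rw [← h, preimage_boxSet, volume_pi, Measure.restrict_pi_pi]
  exact integral_fintype_prod_eq_prod (𝕜 := ℝ) (μ := fun j => volume.restrict (A j)) f

theorem integrableOn_boxSet {k : ℕ} {A : Fin k → Set (ℝ × ℝ)} {f : Fin k → ℝ × ℝ → ℝ}
    (hf : ∀ j, IntegrableOn (f j) (A j)) :
    IntegrableOn (fun p : Param k => ∏ j, f j (p.1 j, p.2 j)) (boxSet A) := by
  rw [← (volume_measurePreserving_arrowProdEquivProdArrow ℝ ℝ (Fin k)).integrableOn_comp_preimage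
    (MeasurableEquiv.measurableEmbedding _), preimage_boxSet, IntegrableOn, volume_pi,
    Measure.restrict_pi_pi]
  exact Integrable.fintype_prod_dep (μ := fun j => volume.restrict (A j)) hf

/-! ### Integral bounds for one design -/

theorem closedBall_subset_halfPlane {z : ℝ × ℝ} {δ : ℝ} (hδ : δ < z.2) :
    Metric.closedBall z δ ⊆ halfPlane := by
  intro w hw
  rw [Metric.mem_closedBall, Prod.dist_eq, max_le_iff, Real.dist_eq, Real.dist_eq] at hw
  have := (abs_le.1 hw.2).1
  show 0 < w.2
  linarith

theorem exists_le_gaussLoss_of_notMem_closedBall (μ : ℝ) {v δ : ℝ} (hv : 0 < v) (hδ : 0 < δ) :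
    ∃ η > 0, ∀ᶠ θ : ℝ × ℝ in 𝓝 (μ, v), ∀ z ∈ halfPlane \ Metric.closedBall (μ, v) δ,
      η ≤ gaussLoss θ.1 θ.2 z := by
  obtain ⟨η, hη, h⟩ := exists_le_gaussLoss_of_not_near μ hv hδ
  refine ⟨η, hη, h.mono fun θ hθ z hz => hθ z hz.1 fun hn => hz.2 ?_⟩
  rwa [Metric.mem_closedBall, Prod.dist_eq, max_le_iff, Real.dist_eq, Real.dist_eq]

theorem integrableOn_exp_gaussLoss {A : Set (ℝ × ℝ)} (hA : MeasurableSet A) (hAQ : A ⊆ halfPlane)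
    (hfin : volume A ≠ ⊤) {m s : ℝ} (hs : 0 < s) (a : ℕ) :
    IntegrableOn (fun z => Real.exp (-(a * gaussLoss m s z))) A := by
  refine Measure.integrableOn_of_bounded (M := 1) hfin ?_ ?_
  · exact ((measurable_gaussLoss m s).const_mul _).neg.exp.aestronglyMeasurable
  · refine (ae_restrict_iff' hA).2 (Eventually.of_forall fun z hz => ?_)
    rw [Real.norm_eq_abs, Real.abs_exp, Real.exp_le_one_iff, neg_nonpos]
    exact mul_nonneg a.cast_nonneg (gaussLoss_nonneg hs (hAQ hz))

theorem mul_exp_le_setIntegral_exp_gaussLoss {A : Set (ℝ × ℝ)} (hA : MeasurableSet A)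
    (hAQ : A ⊆ halfPlane) (hfin : volume A ≠ ⊤) {m s r : ℝ} (hs : 0 < s) (a : ℕ)
    (hr : ∀ z ∈ A, gaussLoss m s z ≤ r) :
    volume.real A * Real.exp (-(a * r)) ≤ ∫ z in A, Real.exp (-(a * gaussLoss m s z)) := by
  have h := setIntegral_mono_on (f := fun _ => Real.exp (-(a * r)))
    (integrableOn_const hfin) (integrableOn_exp_gaussLoss hA hAQ hfin hs a) hA
    fun z hz => Real.exp_le_exp.2 (neg_le_neg (mul_le_mul_of_nonneg_left (hr z hz) a.cast_nonneg))
  rwa [setIntegral_const, smul_eq_mul] at h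

/-- The fixed power of the normalized likelihood that makes it integrable. -/
noncomputable def envelope (m s : ℝ) (z : ℝ × ℝ) : ℝ :=
  (1 + |z.1|) * Real.exp (-(8 * gaussLoss m s z))

theorem envelope_nonneg (m s : ℝ) (z : ℝ × ℝ) : 0 ≤ envelope m s z := by
  unfold envelope; positivity

theorem measurable_envelope (m s : ℝ) : Measurable (envelope m s) := by
  have := measurable_gaussLoss m s
  unfold envelope
  fun_prop

theorem exists_integral_envelope_le (μ : ℝ) {v : ℝ} (hv : 0 < v) :
    ∃ M > 0, ∀ᶠ θ : ℝ × ℝ in 𝓝 (μ, v), IntegrableOn (envelope θ.1 θ.2) halfPlane ∧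
      ∫ z in halfPlane, envelope θ.1 θ.2 z ≤ M := by
  obtain ⟨c, hc, h⟩ := exists_one_add_abs_mul_exp_le μ hv
  have hint : Integrable (fun z : ℝ × ℝ => c * ((1 + z.1 ^ 2)⁻¹ * (1 + z.2 ^ 2)⁻¹)) :=
    (integrable_inv_one_add_sq.mul_prod integrable_inv_one_add_sq).const_mul c
  refine ⟨(∫ z in halfPlane, c * ((1 + z.1 ^ 2)⁻¹ * (1 + z.2 ^ 2)⁻¹)) + 1, ?_, ?_⟩
  · have : 0 ≤ ∫ z in halfPlane, c * ((1 + z.1 ^ 2)⁻¹ * (1 + z.2 ^ 2)⁻¹) :=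
      integral_nonneg fun z => by positivity
    linarith
  · filter_upwards [h] with θ hθ
    have hi : IntegrableOn (envelope θ.1 θ.2) halfPlane := by
      refine hint.integrableOn.mono' (measurable_envelope _ _).aestronglyMeasurable ?_
      refine (ae_restrict_iff' measurableSet_halfPlane).2 (Eventually.of_forall fun z hz => ?_)
      rw [Real.norm_eq_abs, abs_of_nonneg (envelope_nonneg _ _ _)]
      exact hθ z hz
    refine ⟨hi, ?_⟩
    have := setIntegral_mono_on hi hint.integrableOn measurableSet_halfPlane hθ
    linarith

/-- Split the exponent as `a = (a - 8) + 8`: the eight powers ensure integrability, the others the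
decay. -/
theorem one_add_abs_mul_exp_le_envelope {m s : ℝ} {z : ℝ × ℝ}
    {a : ℕ} (ha : 8 ≤ a) {r : ℝ} (hr : r ≤ gaussLoss m s z) :
    (1 + |z.1|) * Real.exp (-(a * gaussLoss m s z)) ≤
      Real.exp (-((a - 8) * r)) * envelope m s z := by
  have ha' : (8 : ℝ) ≤ a := by exact_mod_cast ha
  rw [envelope, mul_left_comm, ← Real.exp_add]
  gcongr
  nlinarith

theorem one_add_abs_mul_exp_le_envelope' {m s : ℝ} {z : ℝ × ℝ} (hs : 0 < s) (hz : z ∈ halfPlane)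
    {a : ℕ} (ha : 8 ≤ a) :
    (1 + |z.1|) * Real.exp (-(a * gaussLoss m s z)) ≤ envelope m s z := by
  simpa using one_add_abs_mul_exp_le_envelope ha (gaussLoss_nonneg hs hz)

theorem exp_le_envelope {m s : ℝ} {z : ℝ × ℝ} (hs : 0 < s) (hz : z ∈ halfPlane)
    {a : ℕ} (ha : 8 ≤ a) :
    Real.exp (-(a * gaussLoss m s z)) ≤ envelope m s z := by
  refine le_trans ?_ (one_add_abs_mul_exp_le_envelope' hs hz ha)
  exact le_mul_of_one_le_left (Real.exp_pos _).le (by linarith [abs_nonneg z.1])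

theorem integrableOn_one_add_abs_mul_exp {m s : ℝ} (hs : 0 < s) {a : ℕ} (ha : 8 ≤ a)
    (hint : IntegrableOn (envelope m s) halfPlane) :
    IntegrableOn (fun z => (1 + |z.1|) * Real.exp (-(a * gaussLoss m s z))) halfPlane := by
  refine hint.mono' ?_ ?_
  · have := measurable_gaussLoss m s
    exact Measurable.aestronglyMeasurable (by fun_prop)
  · refine (ae_restrict_iff' measurableSet_halfPlane).2 (Eventually.of_forall fun z hz => ?_)
    rw [Real.norm_eq_abs, abs_of_nonneg (by positivity)]
    exact one_add_abs_mul_exp_le_envelope' hs hz ha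

theorem integrableOn_exp_halfPlane {m s : ℝ} (hs : 0 < s) {a : ℕ} (ha : 8 ≤ a)
    (hint : IntegrableOn (envelope m s) halfPlane) :
    IntegrableOn (fun z => Real.exp (-(a * gaussLoss m s z))) halfPlane := by
  refine hint.mono' ?_ ?_
  · have := measurable_gaussLoss m s
    exact Measurable.aestronglyMeasurable (by fun_prop)
  · refine (ae_restrict_iff' measurableSet_halfPlane).2 (Eventually.of_forall fun z hz => ?_)
    rw [Real.norm_eq_abs, Real.abs_exp]
    exact exp_le_envelope hs hz ha

/-! ### Concentration of one design near its true parameters -/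

section Concentration

variable {μ v : ℝ} {m s : ℕ → ℝ} {N : ℕ → ℕ}

/-- The loss vanishes at the truth, so by continuity it is at most `ε` on a fixed smaller ball,
whose volume serves as `w`. -/
theorem exists_mul_exp_le_setIntegral_closedBall (hv : 0 < v)
    (hθ : Tendsto (fun n => (m n, s n)) atTop (𝓝 (μ, v))) {δ : ℝ} (hδ : 0 < δ) (hδv : δ < v)
    {ε : ℝ} (hε : 0 < ε) :
    ∃ w > 0, ∀ᶠ n in atTop, w * Real.exp (-(N n * ε)) ≤
      ∫ z in Metric.closedBall (μ, v) δ, Real.exp (-(N n * gaussLoss (m n) (s n) z)) := by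
  obtain ⟨δ', hδ', h⟩ := eventually_gaussLoss_le (μ := μ) (z₀ := (μ, v)) hv hv hε
  have h0 : gaussLoss μ v (μ, v) = 0 := by
    have := gaussLoss_profile (m := μ) hv μ
    simpa using this
  set ρ := min δ δ'
  have hρ : 0 < ρ := lt_min hδ hδ'
  have hfin : volume (Metric.closedBall (μ, v) ρ) ≠ ⊤ := measure_closedBall_lt_top.ne
  have hsub : Metric.closedBall (μ, v) δ ⊆ halfPlane := closedBall_subset_halfPlane hδv
  have hsub' : Metric.closedBall (μ, v) ρ ⊆ Metric.closedBall (μ, v) δ :=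
    Metric.closedBall_subset_closedBall (min_le_left _ _)
  refine ⟨volume.real (Metric.closedBall (μ, v) ρ),
    ENNReal.toReal_pos (Metric.measure_closedBall_pos _ _ hρ).ne' hfin, ?_⟩
  have hs : Tendsto s atTop (𝓝 v) := (continuous_snd.tendsto _).comp hθ
  filter_upwards [hθ.eventually h, hs.eventually (lt_mem_nhds hv)] with n hn hsn
  refine (mul_exp_le_setIntegral_exp_gaussLoss measurableSet_closedBall (hsub'.trans hsub) hfin hsn
    (N n) (m := m n) (r := ε) fun z hz => ?_).trans ?_
  · have := hn z (hz.trans (min_le_right _ _))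
    rwa [h0, zero_add] at this
  · refine setIntegral_mono_set (integrableOn_exp_gaussLoss measurableSet_closedBall hsub
      measure_closedBall_lt_top.ne hsn _) (Eventually.of_forall fun z => (Real.exp_pos _).le)
      hsub'.eventuallyLE

theorem setIntegral_closedBall_pos (hv : 0 < v)
    (hθ : Tendsto (fun n => (m n, s n)) atTop (𝓝 (μ, v))) {δ : ℝ} (hδ : 0 < δ) (hδv : δ < v) :
    ∀ᶠ n in atTop,
      0 < ∫ z in Metric.closedBall (μ, v) δ, Real.exp (-(N n * gaussLoss (m n) (s n) z)) := by
  obtain ⟨w, hw, h⟩ := exists_mul_exp_le_setIntegral_closedBall (N := N) hv hθ hδ hδv one_pos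
  exact h.mono fun n hn => lt_of_lt_of_le (by positivity) hn

/-- Off the ball the loss is at least `η`, while the ball itself has mass at least `w * exp (-N * η
/ 2)`. -/
theorem tendsto_ratio_diff_closedBall (hv : 0 < v)
    (hθ : Tendsto (fun n => (m n, s n)) atTop (𝓝 (μ, v))) (hN : Tendsto N atTop atTop)
    {δ : ℝ} (hδ : 0 < δ) (hδv : δ < v) :
    Tendsto (fun n =>
      (∫ z in halfPlane \ Metric.closedBall (μ, v) δ,
        (1 + |z.1|) * Real.exp (-(N n * gaussLoss (m n) (s n) z))) /
      ∫ z in Metric.closedBall (μ, v) δ, Real.exp (-(N n * gaussLoss (m n) (s n) z)))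
      atTop (𝓝 0) := by
  obtain ⟨η, hη, h1⟩ := exists_le_gaussLoss_of_notMem_closedBall μ hv hδ
  obtain ⟨w, hw, h2⟩ :=
    exists_mul_exp_le_setIntegral_closedBall (N := N) hv hθ hδ hδv (half_pos hη)
  obtain ⟨M, hM, h3⟩ := exists_integral_envelope_le μ hv
  have hs : Tendsto s atTop (𝓝 v) := (continuous_snd.tendsto _).comp hθ
  have hlim : Tendsto (fun n => M / w * Real.exp (8 * η) * Real.exp (-((N n : ℝ) * (η / 2))))
      atTop (𝓝 0) := by
    have : Tendsto (fun n => (N n : ℝ) * (η / 2)) atTop atTop :=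
      (tendsto_natCast_atTop_atTop.comp hN).atTop_mul_const (half_pos hη)
    simpa using (Real.tendsto_exp_neg_atTop_nhds_zero.comp this).const_mul
      (M / w * Real.exp (8 * η))
  refine tendsto_of_tendsto_of_tendsto_of_le_of_le' tendsto_const_nhds hlim ?_ ?_
  · exact Eventually.of_forall fun n => div_nonneg
      (integral_nonneg fun z => by positivity) (integral_nonneg fun z => by positivity)
  · filter_upwards [hθ.eventually h1, h2, hθ.eventually h3, hs.eventually (lt_mem_nhds hv),
      hN.eventually_ge_atTop 8] with n g1 g2 g3 hsn hNn
    have hmeas : MeasurableSet (halfPlane \ Metric.closedBall (μ, v) δ) :=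
      measurableSet_halfPlane.diff measurableSet_closedBall
    have hnum : ∫ z in halfPlane \ Metric.closedBall (μ, v) δ,
        (1 + |z.1|) * Real.exp (-(N n * gaussLoss (m n) (s n) z)) ≤
        Real.exp (-((N n - 8) * η)) * M := by
      calc _ ≤ ∫ z in halfPlane \ Metric.closedBall (μ, v) δ,
            Real.exp (-((N n - 8) * η)) * envelope (m n) (s n) z := by
            refine setIntegral_mono_on ((integrableOn_one_add_abs_mul_exp hsn hNn g3.1).mono_set
              sdiff_subset) ((g3.1.mono_set sdiff_subset).const_mul _) hmeas fun z hz => ?_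
            exact one_add_abs_mul_exp_le_envelope hNn (g1 z hz)
        _ = Real.exp (-((N n - 8) * η)) *
            ∫ z in halfPlane \ Metric.closedBall (μ, v) δ, envelope (m n) (s n) z :=
            integral_const_mul _ _
        _ ≤ Real.exp (-((N n - 8) * η)) * M := by
            refine mul_le_mul_of_nonneg_left (le_trans ?_ g3.2) (Real.exp_pos _).le
            exact setIntegral_mono_set g3.1 (Eventually.of_forall fun z => envelope_nonneg _ _ _)
              sdiff_subset.eventuallyLE
    have hden : 0 < w * Real.exp (-(N n * (η / 2))) := by positivity
    calc _ ≤ Real.exp (-((N n - 8) * η)) * M / (w * Real.exp (-(N n * (η / 2)))) := by gcongr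
      _ = M / w * (Real.exp (-((N n - 8) * η)) / Real.exp (-(N n * (η / 2)))) := by
        field_simp
      _ = M / w * Real.exp (8 * η) * Real.exp (-((N n : ℝ) * (η / 2))) := by
        rw [← Real.exp_sub, mul_assoc, ← Real.exp_add]
        ring_nf

theorem tendsto_ratio_closedBall (hv : 0 < v)
    (hθ : Tendsto (fun n => (m n, s n)) atTop (𝓝 (μ, v))) (hN : Tendsto N atTop atTop)
    {δ : ℝ} (hδ : 0 < δ) (hδv : δ < v) :
    Tendsto (fun n =>
      (∫ z in halfPlane, Real.exp (-(N n * gaussLoss (m n) (s n) z))) /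
      ∫ z in Metric.closedBall (μ, v) δ, Real.exp (-(N n * gaussLoss (m n) (s n) z)))
      atTop (𝓝 1) := by
  obtain ⟨M, hM, h3⟩ := exists_integral_envelope_le μ hv
  have hs : Tendsto s atTop (𝓝 v) := (continuous_snd.tendsto _).comp hθ
  have hlim := (tendsto_ratio_diff_closedBall hv hθ hN hδ hδv).const_add 1
  rw [add_zero] at hlim
  have hsub : Metric.closedBall (μ, v) δ ⊆ halfPlane := closedBall_subset_halfPlane hδv
  refine tendsto_of_tendsto_of_tendsto_of_le_of_le' tendsto_const_nhds hlim ?_ ?_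
  all_goals
    filter_upwards [setIntegral_closedBall_pos (N := N) hv hθ hδ hδv, hθ.eventually h3,
      hs.eventually (lt_mem_nhds hv), hN.eventually_ge_atTop 8] with n hpos g3 hsn hNn
    have hint := integrableOn_exp_halfPlane hsn hNn g3.1
  · rw [one_le_div hpos]
    exact setIntegral_mono_set hint (Eventually.of_forall fun z => (Real.exp_pos _).le)
      hsub.eventuallyLE
  · rw [div_le_iff₀ hpos, add_mul, one_mul, div_mul_cancel₀ _ hpos.ne']
    have hsplit := integral_add_compl (μ := volume.restrict halfPlane)
      (measurableSet_closedBall (x := (μ, v)) (ε := δ)) hint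
    rw [Measure.restrict_restrict measurableSet_closedBall, inter_eq_left.2 hsub,
      Measure.restrict_restrict measurableSet_closedBall.compl, inter_comm, ← sdiff_eq] at hsplit
    rw [← hsplit]
    refine add_le_add le_rfl ?_
    refine setIntegral_mono_on (hint.mono_set sdiff_subset)
      ((integrableOn_one_add_abs_mul_exp hsn hNn g3.1).mono_set sdiff_subset)
      (measurableSet_halfPlane.diff measurableSet_closedBall) fun z _ => ?_
    exact le_mul_of_one_le_left (Real.exp_pos _).le (by linarith [abs_nonneg z.1])

end Concentration

/-! ### The likelihood in terms of sample mean and variance -/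

/-- The mean of the first `N` terms of a sequence. -/
noncomputable def sampleMean (x : ℕ → ℝ) (N : ℕ) : ℝ := (∑ l ∈ Finset.range N, x l) / N

/-- The (biased) variance of the first `N` terms of a sequence. -/
noncomputable def sampleVar (x : ℕ → ℝ) (N : ℕ) : ℝ :=
  (∑ l ∈ Finset.range N, x l ^ 2) / N - sampleMean x N ^ 2

theorem sum_sub_sq (x : ℕ → ℝ) (N : ℕ) (φ : ℝ) :
    ∑ l ∈ Finset.range N, (x l - φ) ^ 2 = N * (sampleVar x N + (sampleMean x N - φ) ^ 2) := by
  rcases N.eq_zero_or_pos with rfl | hN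
  · simp
  have hN' : (N : ℝ) ≠ 0 := by positivity
  have h : ∑ l ∈ Finset.range N, (x l - φ) ^ 2 =
      ∑ l ∈ Finset.range N, x l ^ 2 - 2 * φ * ∑ l ∈ Finset.range N, x l + N * φ ^ 2 := by
    simp only [sub_sq, Finset.sum_add_distrib, Finset.sum_sub_distrib, Finset.sum_const,
      Finset.card_range, nsmul_eq_mul, Finset.mul_sum]
    congr 2
    exact Finset.sum_congr rfl fun l _ => by ring
  rw [h, sampleVar, sampleMean]
  field_simp
  ring

theorem prod_gaussianPDFReal (x : ℕ → ℝ) (N : ℕ) (hs : 0 < sampleVar x N) {z : ℝ × ℝ}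
    (hz : z ∈ halfPlane) :
    ∏ l ∈ Finset.range N, gaussianPDFReal z.1 z.2.toNNReal (x l) =
      Real.exp (-(N * (1 / 2 * Real.log (2 * Real.pi * sampleVar x N) + 1 / 2))) *
        Real.exp (-(N * gaussLoss (sampleMean x N) (sampleVar x N) z)) := by
  have hψ : 0 < z.2 := hz
  have h1 : ∀ y, gaussianPDFReal z.1 z.2.toNNReal y =
      Real.exp (-(1 / 2 * Real.log (2 * Real.pi * z.2)) - (y - z.1) ^ 2 / (2 * z.2)) := by
    intro y
    rw [gaussianPDFReal, Real.coe_toNNReal _ hψ.le, Real.exp_sub, Real.exp_neg,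
      Real.sqrt_eq_rpow, Real.rpow_def_of_pos (by positivity), neg_div, mul_comm (Real.log _),
      Real.exp_neg, ← div_eq_mul_inv]
  simp only [h1]
  rw [← Real.exp_sum, ← Real.exp_add, Finset.sum_sub_distrib, ← Finset.sum_div, sum_sub_sq,
    Finset.sum_const, Finset.card_range, nsmul_eq_mul, gaussLoss,
    Real.log_div hψ.ne' hs.ne', Real.log_mul (by positivity) hψ.ne',
    Real.log_mul (by positivity) hs.ne']
  congr 1
  ring

/-- The likelihood of normal samples with means `m j`, variances `s j` and sizes `N j`, relative to
its maximum. -/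
noncomputable def relLikelihood {k : ℕ} (m s : Fin k → ℝ) (N : Fin k → ℕ) (p : Param k) : ℝ :=
  ∏ j, Real.exp (-(N j * gaussLoss (m j) (s j) (p.1 j, p.2 j)))

theorem exists_likelihood_eq {k : ℕ} (x : Fin k → ℕ → ℝ) (N : Fin k → ℕ)
    (hs : ∀ j, 0 < sampleVar (x j) (N j)) :
    ∃ K > 0, ∀ p ∈ paramSpace k, likelihood x N p =
      K * relLikelihood (fun j => sampleMean (x j) (N j)) (fun j => sampleVar (x j) (N j)) N p := by
  refine ⟨∏ j, Real.exp (-(N j * (1 / 2 * Real.log (2 * Real.pi * sampleVar (x j) (N j)) + 1 / 2))),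
    Finset.prod_pos fun j _ => Real.exp_pos _, fun p hp => ?_⟩
  rw [relLikelihood, ← Finset.prod_mul_distrib, likelihood]
  exact Finset.prod_congr rfl fun j _ => 
    prod_gaussianPDFReal (x j) (N j) (hs j) (z := (p.1 j, p.2 j)) (hp j)

/-! ### Upper and lower Laplace bounds for the prior-weighted likelihood -/

section

variable {k : ℕ} {m s : Fin k → ℝ} {N : Fin k → ℕ} {π₀ : Param k → ℝ} {C : ℝ}

theorem measurable_relLikelihood : Measurable (relLikelihood m s N) := by
  unfold relLikelihood
  refine Finset.measurable_prod _ fun j _ => ?_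
  have := (measurable_gaussLoss (m j) (s j)).comp
    (f := fun p : Param k => (p.1 j, p.2 j)) (by fun_prop)
  exact (this.const_mul _).neg.exp

theorem relLikelihood_nonneg (p : Param k) : 0 ≤ relLikelihood m s N p :=
  Finset.prod_nonneg fun _ _ => (Real.exp_pos _).le

theorem relLikelihood_le_one (hs : ∀ j, 0 < s j) {p : Param k} (hp : p ∈ paramSpace k) :
    relLikelihood m s N p ≤ 1 := by
  refine Finset.prod_le_one (fun _ _ => (Real.exp_pos _).le) fun j _ => ?_
  rw [Real.exp_le_one_iff, neg_nonpos]
  exact mul_nonneg (N j).cast_nonneg (gaussLoss_nonneg (hs j) (hp j))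

theorem integrableOn_mul_relLikelihood (hs : ∀ j, 0 < s j)
    (hint : IntegrableOn π₀ (paramSpace k)) :
    IntegrableOn (fun p => π₀ p * relLikelihood m s N p) (paramSpace k) := by
  refine hint.norm.mono' (hint.aestronglyMeasurable.mul
    measurable_relLikelihood.aestronglyMeasurable) ?_
  refine (ae_restrict_iff' (measurableSet_paramSpace k)).2 (Eventually.of_forall fun p hp => ?_)
  rw [norm_mul, Real.norm_of_nonneg (relLikelihood_nonneg p)]
  exact mul_le_of_le_one_right (norm_nonneg _) (relLikelihood_le_one hs hp)

theorem relLikelihood_le_prod_envelope (hN : ∀ j, 8 ≤ N j) {R : ℝ} (p : Param k)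
    (hR : R ≤ ∑ j, ((N j : ℝ) - 8) * gaussLoss (m j) (s j) (p.1 j, p.2 j)) (i : Fin k) :
    (1 + |p.1 i|) * relLikelihood m s N p ≤
      Real.exp (-R) * ∏ j, envelope (m j) (s j) (p.1 j, p.2 j) := by
  -- Weighting every coordinate, not only the `i`-th, lets the bound factor over the designs.
  have h1 : 1 + |p.1 i| ≤ ∏ j, (1 + |p.1 j|) := by
    rw [← Finset.mul_prod_erase _ _ (Finset.mem_univ i)]
    exact le_mul_of_one_le_right (by positivity)
      (Finset.one_le_prod fun j => by simp)
  calc (1 + |p.1 i|) * relLikelihood m s N p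
      ≤ (∏ j, (1 + |p.1 j|)) * relLikelihood m s N p :=
        mul_le_mul_of_nonneg_right h1 (relLikelihood_nonneg p)
    _ = ∏ j, (1 + |p.1 j|) * Real.exp (-(N j * gaussLoss (m j) (s j) (p.1 j, p.2 j))) := by
        rw [relLikelihood, Finset.prod_mul_distrib]
    _ ≤ ∏ j, Real.exp (-(((N j : ℝ) - 8) * gaussLoss (m j) (s j) (p.1 j, p.2 j))) *
          envelope (m j) (s j) (p.1 j, p.2 j) :=
        Finset.prod_le_prod (fun j _ => by positivity) fun j _ =>
          one_add_abs_mul_exp_le_envelope (z := (p.1 j, p.2 j)) (hN j) le_rfl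
    _ = Real.exp (-∑ j, ((N j : ℝ) - 8) * gaussLoss (m j) (s j) (p.1 j, p.2 j)) *
          ∏ j, envelope (m j) (s j) (p.1 j, p.2 j) := by
        rw [Finset.prod_mul_distrib, ← Real.exp_sum, Finset.sum_neg_distrib]
    _ ≤ _ := by
        refine mul_le_mul_of_nonneg_right (Real.exp_le_exp.2 (neg_le_neg hR))
          (Finset.prod_nonneg fun j _ => envelope_nonneg _ _ _)

theorem integrableOn_mean_mul_relLikelihood (hs : ∀ j, 0 < s j) (hN : ∀ j, 8 ≤ N j)
    (henv : ∀ j, IntegrableOn (envelope (m j) (s j)) halfPlane)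
    (hint : IntegrableOn π₀ (paramSpace k)) (h0 : ∀ p ∈ paramSpace k, 0 ≤ π₀ p)
    (hC : ∀ p ∈ paramSpace k, π₀ p ≤ C) (i : Fin k) :
    IntegrableOn (fun p => p.1 i * (π₀ p * relLikelihood m s N p)) (paramSpace k) := by
  have hdom : IntegrableOn (fun p : Param k => C * ∏ j, envelope (m j) (s j) (p.1 j, p.2 j))
      (paramSpace k) := (integrableOn_boxSet (f := fun j => envelope (m j) (s j)) henv).const_mul C
  refine hdom.mono' ?_ ?_
  · refine AEStronglyMeasurable.mul ?_ (hint.aestronglyMeasurable.mul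
      measurable_relLikelihood.aestronglyMeasurable)
    exact Measurable.aestronglyMeasurable (by fun_prop)
  · refine (ae_restrict_iff' (measurableSet_paramSpace k)).2 (Eventually.of_forall fun p hp => ?_)
    have h1 := relLikelihood_le_prod_envelope (m := m) (s := s) hN (R := 0) p
      (Finset.sum_nonneg fun j _ => mul_nonneg
        (by have : (8 : ℝ) ≤ N j := by exact_mod_cast hN j
            linarith) (gaussLoss_nonneg (hs j) (hp j))) i
    rw [neg_zero, Real.exp_zero, one_mul] at h1
    have h2 := relLikelihood_nonneg (m := m) (s := s) (N := N) p
    rw [Real.norm_eq_abs, abs_mul, abs_of_nonneg (mul_nonneg (h0 p hp) h2)]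
    calc |p.1 i| * (π₀ p * relLikelihood m s N p)
        = π₀ p * (|p.1 i| * relLikelihood m s N p) := by ring
      _ ≤ C * ((1 + |p.1 i|) * relLikelihood m s N p) := by
          refine mul_le_mul (hC p hp) ?_ (by positivity) ((h0 p hp).trans (hC p hp))
          exact mul_le_mul_of_nonneg_right (by linarith) h2
      _ ≤ _ := mul_le_mul_of_nonneg_left h1 ((h0 p hp).trans (hC p hp))

/-- The upper Laplace bound: `R` bounds the exponent left after eight powers per design are
reserved, and the reserved powers integrate to a product. -/
theorem setIntegral_mul_relLikelihood_le (hN : ∀ j, 8 ≤ N j) (hs : ∀ j, 0 < s j)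
    (henv : ∀ j, IntegrableOn (envelope (m j) (s j)) halfPlane)
    (hint : IntegrableOn π₀ (paramSpace k))
    (hC0 : 0 ≤ C) (hC : ∀ p ∈ paramSpace k, π₀ p ≤ C) {S : Set (Param k)} (hS : MeasurableSet S)
    (hSP : S ⊆ paramSpace k) {R : ℝ}
    (hR : ∀ p ∈ S, R ≤ ∑ j, ((N j : ℝ) - 8) * gaussLoss (m j) (s j) (p.1 j, p.2 j)) :
    ∫ p in S, π₀ p * relLikelihood m s N p ≤
      C * Real.exp (-R) * ∏ j, ∫ z in halfPlane, envelope (m j) (s j) z := by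
  have hprod : IntegrableOn (fun p : Param k => ∏ j, envelope (m j) (s j) (p.1 j, p.2 j))
    (paramSpace k) := integrableOn_boxSet (f := fun j => envelope (m j) (s j)) henv
  have hnn : ∀ p : Param k, 0 ≤ ∏ j, envelope (m j) (s j) (p.1 j, p.2 j) := fun p =>
    Finset.prod_nonneg fun j _ => envelope_nonneg _ _ _
  have hrl : ∀ p ∈ S, relLikelihood m s N p ≤
      Real.exp (-R) * ∏ j, envelope (m j) (s j) (p.1 j, p.2 j) := by
    intro p hp
    rw [relLikelihood]
    -- The pointwise envelope bound needs an index; without designs both products are 1.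
    rcases isEmpty_or_nonempty (Fin k) with he | ⟨⟨i⟩⟩
    · have := hR p hp
      simp at this ⊢
      exact this
    · refine le_trans ?_ (relLikelihood_le_prod_envelope hN p (hR p hp) i)
      exact le_mul_of_one_le_left (relLikelihood_nonneg p) (by simp)
  calc ∫ p in S, π₀ p * relLikelihood m s N p
      ≤ ∫ p in S, C * Real.exp (-R) * ∏ j, envelope (m j) (s j) (p.1 j, p.2 j) := by
        refine setIntegral_mono_on ((integrableOn_mul_relLikelihood hs hint).mono_set hSP)
          ((hprod.mono_set hSP).const_mul _) hS fun p hp => ?_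
        rw [mul_assoc]
        exact mul_le_mul (hC p (hSP hp)) (hrl p hp) (relLikelihood_nonneg p) hC0
    _ = C * Real.exp (-R) * ∫ p in S, ∏ j, envelope (m j) (s j) (p.1 j, p.2 j) :=
        integral_const_mul _ _
    _ ≤ C * Real.exp (-R) * ∫ p in paramSpace k, ∏ j, envelope (m j) (s j) (p.1 j, p.2 j) := by
        refine mul_le_mul_of_nonneg_left ?_ (by positivity)
        exact setIntegral_mono_set hprod (Eventually.of_forall hnn) hSP.eventuallyLE
    _ = _ := by
        rw [paramSpace_eq_boxSet,
          setIntegral_boxSet (fun _ => halfPlane) fun j => envelope (m j) (s j)]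

theorem prod_le_setIntegral_mul_relLikelihood (hs : ∀ j, 0 < s j)
    (hint : IntegrableOn π₀ (paramSpace k)) (h0 : ∀ p ∈ paramSpace k, 0 ≤ π₀ p)
    {A : Fin k → Set (ℝ × ℝ)} (hA : ∀ j, MeasurableSet (A j)) (hfin : ∀ j, volume (A j) ≠ ⊤)
    (hAQ : ∀ j, A j ⊆ halfPlane) {c : ℝ} (hc : ∀ p ∈ boxSet A, c ≤ π₀ p) {S : Set (Param k)}
    (hS : MeasurableSet S) (hSP : S ⊆ paramSpace k) (hAS : boxSet A ⊆ S) :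
    c * ∏ j, ∫ z in A j, Real.exp (-(N j * gaussLoss (m j) (s j) z)) ≤
      ∫ p in S, π₀ p * relLikelihood m s N p := by
  have hi := (integrableOn_mul_relLikelihood (m := m) (N := N) hs hint).mono_set hSP
  calc c * ∏ j, ∫ z in A j, Real.exp (-(N j * gaussLoss (m j) (s j) z))
      = ∫ p in boxSet A, c * relLikelihood m s N p := by
        rw [integral_const_mul]
        congr 1
        exact (setIntegral_boxSet A fun j z => Real.exp (-(N j * gaussLoss (m j) (s j) z))).symm
    _ ≤ ∫ p in boxSet A, π₀ p * relLikelihood m s N p := by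
        refine setIntegral_mono_on ?_ (hi.mono_set hAS) (measurableSet_boxSet hA) fun p hp =>
          mul_le_mul_of_nonneg_right (hc p hp) (relLikelihood_nonneg p)
        refine Integrable.const_mul ?_ c
        exact integrableOn_boxSet (f := fun j z => Real.exp (-(N j * gaussLoss (m j) (s j) z)))
          fun j => integrableOn_exp_gaussLoss (hA j) (hAQ j) (hfin j) (hs j) (N j)
    _ ≤ _ := by
        refine setIntegral_mono_set hi ?_ hAS.eventuallyLE
        exact (ae_restrict_iff' hS).2 (Eventually.of_forall fun p hp =>
          mul_nonneg (h0 p (hSP hp)) (relLikelihood_nonneg p))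

end

/-! ### The prior near the relevant parameters -/

theorem IsAdmissiblePrior.integrableOn {k : ℕ} {μ σ : Fin k → ℝ} {π₀ : Param k → ℝ}
    (hπ : IsAdmissiblePrior μ σ π₀) : IntegrableOn π₀ (paramSpace k) := by
  by_contra h
  have := hπ.integral_eq_one
  rw [integral_undef h] at this
  exact zero_ne_one this

/-- The margin of the prior box becomes a radius. The admissible centres include the true parameters
and every profile point `(φ, σ_j² + (μ_j - φ)²)` with `φ` between the extreme means. -/
theorem IsAdmissiblePrior.exists_le_on_closedBall {k : ℕ} {μ σ : Fin k → ℝ} {π₀ : Param k → ℝ}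
    (hπ : IsAdmissiblePrior μ σ π₀) :
    ∃ ρ > 0, ρ < ⨅ j, σ j ^ 2 ∧ ∃ c > 0, ∀ z : Fin k → ℝ × ℝ,
      (∀ j, (z j).1 ∈ Icc (⨅ j, μ j) (⨆ j, μ j) ∧
        (z j).2 ∈ Icc (⨅ j, σ j ^ 2) ((⨆ j, σ j ^ 2) + ((⨆ j, μ j) - ⨅ j, μ j) ^ 2)) →
      ∀ p ∈ boxSet (fun j => Metric.closedBall (z j) ρ), c ≤ π₀ p := by
  obtain ⟨ε, hε, hεσ, c, hc, h⟩ := hπ.bounded_below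
  refine ⟨ε, hε, by linarith, c, hc, fun z hz p hp => h p fun j => ?_⟩
  obtain ⟨⟨h1, h2⟩, h3, h4⟩ := hz j
  have hpj := hp j
  rw [Metric.mem_closedBall, Prod.dist_eq, max_le_iff, Real.dist_eq, Real.dist_eq, abs_le,
    abs_le] at hpj
  obtain ⟨⟨g1, g2⟩, g3, g4⟩ := hpj
  simp only at g1 g2 g3 g4
  have hD : 0 ≤ (⨆ j, μ j) - ⨅ j, μ j := by linarith
  refine ⟨⟨by linarith, by linarith⟩, by linarith, ?_⟩
  nlinarith

/-! ### Consistency of the posterior means -/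

section

variable {k : ℕ} {μ σ : Fin k → ℝ} {π₀ : Param k → ℝ} {m s : ℕ → Fin k → ℝ} {N : ℕ → Fin k → ℕ}

theorem true_mem_box (j : Fin k) : μ j ∈ Icc (⨅ j, μ j) (⨆ j, μ j) ∧
    σ j ^ 2 ∈ Icc (⨅ j, σ j ^ 2) ((⨆ j, σ j ^ 2) + ((⨆ j, μ j) - ⨅ j, μ j) ^ 2) := by
  have h1 := ciInf_le (Set.finite_range μ).bddBelow j
  have h2 := le_ciSup (Set.finite_range μ).bddAbove j
  have h3 := ciInf_le (Set.finite_range fun j => σ j ^ 2).bddBelow j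
  have h4 := le_ciSup (Set.finite_range fun j => σ j ^ 2).bddAbove j
  exact ⟨⟨h1, h2⟩, h3, h4.trans (le_add_of_nonneg_right (sq_nonneg _))⟩

theorem eventually_regular (hσ : ∀ j, 0 < σ j)
    (hθ : ∀ j, Tendsto (fun n => (m n j, s n j)) atTop (𝓝 (μ j, σ j ^ 2)))
    (hN : ∀ j, Tendsto (fun n => N n j) atTop atTop) :
    ∃ M > 0, ∀ᶠ n in atTop, (∀ j, 0 < s n j) ∧ (∀ j, 8 ≤ N n j) ∧
      (∀ j, IntegrableOn (envelope (m n j) (s n j)) halfPlane) ∧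
      ∏ j, ∫ z in halfPlane, envelope (m n j) (s n j) z ≤ M := by
  have hv : ∀ j, 0 < σ j ^ 2 := fun j => pow_pos (hσ j) 2
  choose M hM h using fun j => exists_integral_envelope_le (μ j) (hv j)
  refine ⟨∏ j, M j, Finset.prod_pos fun j _ => hM j, ?_⟩
  have hs : ∀ j, Tendsto (fun n => s n j) atTop (𝓝 (σ j ^ 2)) := fun j =>
    (continuous_snd.tendsto _).comp (hθ j)
  filter_upwards [eventually_all.2 fun j => (hs j).eventually (lt_mem_nhds (hv j)),
    eventually_all.2 fun j => (hN j).eventually_ge_atTop 8,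
    eventually_all.2 fun j => (hθ j).eventually (h j)] with n h1 h2 h3
  exact ⟨h1, h2, fun j => (h3 j).1, Finset.prod_le_prod
    (fun j _ => integral_nonneg fun z => envelope_nonneg _ _ _) fun j _ => (h3 j).2⟩

theorem eventually_prod_setIntegral_closedBall_pos (hσ : ∀ j, 0 < σ j)
    (hθ : ∀ j, Tendsto (fun n => (m n j, s n j)) atTop (𝓝 (μ j, σ j ^ 2)))
    {ρ : ℝ} (hρ : 0 < ρ) (hρσ : ∀ j, ρ < σ j ^ 2) :
    ∀ᶠ n in atTop, 0 < ∏ j, ∫ z in Metric.closedBall (μ j, σ j ^ 2) ρ,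
      Real.exp (-(N n j * gaussLoss (m n j) (s n j) z)) := by
  filter_upwards [eventually_all.2 fun j => setIntegral_closedBall_pos (N := fun n => N n j)
    (pow_pos (hσ j) 2) (hθ j) hρ (hρσ j)] with n hn
  exact Finset.prod_pos fun j _ => hn j

/-- The evidence is bounded below by the product of the masses of small balls around the true
parameters of the designs. -/
theorem exists_prod_le_evidence (hσ : ∀ j, 0 < σ j) (hπ : IsAdmissiblePrior μ σ π₀)
    (hθ : ∀ j, Tendsto (fun n => (m n j, s n j)) atTop (𝓝 (μ j, σ j ^ 2))) :
    ∃ ρ₀ > 0, (∀ j, ρ₀ < σ j ^ 2) ∧ ∃ c > 0, ∀ ρ ≤ ρ₀, ∀ᶠ n in atTop,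
      c * ∏ j, ∫ z in Metric.closedBall (μ j, σ j ^ 2) ρ,
        Real.exp (-(N n j * gaussLoss (m n j) (s n j) z)) ≤
      ∫ p in paramSpace k, π₀ p * relLikelihood (m n) (s n) (N n) p := by
  obtain ⟨ρ₀, hρ₀, hρσ, c, hc, h⟩ := hπ.exists_le_on_closedBall
  have hρσ' : ∀ j, ρ₀ < σ j ^ 2 := fun j =>
    hρσ.trans_le (ciInf_le (Set.finite_range fun j => σ j ^ 2).bddBelow j)
  refine ⟨ρ₀, hρ₀, hρσ', c, hc, fun ρ hρ => ?_⟩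
  have hs : ∀ j, Tendsto (fun n => s n j) atTop (𝓝 (σ j ^ 2)) := fun j =>
    (continuous_snd.tendsto _).comp (hθ j)
  filter_upwards [eventually_all.2 fun j => (hs j).eventually (lt_mem_nhds (pow_pos (hσ j) 2))]
    with n hn
  have hsub : ∀ j, Metric.closedBall (μ j, σ j ^ 2) ρ ⊆ halfPlane := fun j =>
    closedBall_subset_halfPlane (hρ.trans_lt (hρσ' j))
  refine prod_le_setIntegral_mul_relLikelihood hn hπ.integrableOn hπ.nonneg
    (fun j => measurableSet_closedBall) (fun j => measure_closedBall_lt_top.ne) hsub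
    (fun p hp => ?_) (measurableSet_paramSpace k) subset_rfl (boxSet_mono hsub)
  exact h (fun j => (μ j, σ j ^ 2)) true_mem_box p
    (boxSet_mono (fun j => Metric.closedBall_subset_closedBall hρ) hp)

theorem eventually_evidence_pos (hσ : ∀ j, 0 < σ j) (hπ : IsAdmissiblePrior μ σ π₀)
    (hθ : ∀ j, Tendsto (fun n => (m n j, s n j)) atTop (𝓝 (μ j, σ j ^ 2))) :
    ∀ᶠ n in atTop, 0 < ∫ p in paramSpace k, π₀ p * relLikelihood (m n) (s n) (N n) p := by
  obtain ⟨ρ, hρ, hρσ, c, hc, h⟩ := exists_prod_le_evidence (N := N) hσ hπ hθ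
  filter_upwards [h ρ le_rfl,
    eventually_prod_setIntegral_closedBall_pos (N := N) hσ hθ hρ hρσ] with n h1 h2
  exact (mul_pos hc h2).trans_le h1

/-- Either `φ_i` is within `δ` of `μ_i`, or the pair of design `i` is outside its ball and `|φ_i -
μ_i| ≤ (1 + |μ_i|) * (1 + |φ_i|)`. The second term is a product on a box, so its integral factors.
-/
theorem abs_mean_sub_mul_le {i : Fin k} {δ C π : ℝ} (hδ : 0 ≤ δ) (hπ0 : 0 ≤ π) (hπC : π ≤ C)
    {m s : Fin k → ℝ} {N : Fin k → ℕ} {p : Param k} (hp : p ∈ paramSpace k) :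
    |p.1 i - μ i| * (π * relLikelihood m s N p) ≤
      δ * (π * relLikelihood m s N p) +
        (boxSet fun j => if j = i then halfPlane \ Metric.closedBall (μ j, σ j ^ 2) δ
          else halfPlane).indicator (fun p => C * (1 + |μ i|) *
            ∏ j, (if j = i then 1 + |p.1 j| else 1) *
              Real.exp (-(N j * gaussLoss (m j) (s j) (p.1 j, p.2 j)))) p := by
  have hL := relLikelihood_nonneg (m := m) (s := s) (N := N) p
  have hprod : ∏ j, (if j = i then 1 + |p.1 j| else 1) *
      Real.exp (-(N j * gaussLoss (m j) (s j) (p.1 j, p.2 j))) =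
      (1 + |p.1 i|) * relLikelihood m s N p := by
    rw [Finset.prod_mul_distrib, Finset.prod_ite_eq' Finset.univ i fun j => 1 + |p.1 j|,
      if_pos (Finset.mem_univ i), relLikelihood]
  by_cases hmem : p ∈ boxSet fun j => if j = i then
      halfPlane \ Metric.closedBall (μ j, σ j ^ 2) δ else halfPlane
  · rw [indicator_of_mem hmem, hprod]
    have h1 : |p.1 i - μ i| ≤ (1 + |μ i|) * (1 + |p.1 i|) := by
      have := abs_sub (p.1 i) (μ i)
      nlinarith [abs_nonneg (p.1 i), abs_nonneg (μ i)]
    have h2 : |p.1 i - μ i| * (π * relLikelihood m s N p) ≤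
        ((1 + |μ i|) * (1 + |p.1 i|)) * (C * relLikelihood m s N p) := by gcongr
    have h3 : 0 ≤ δ * (π * relLikelihood m s N p) := by positivity
    linarith
  · rw [indicator_of_notMem hmem, add_zero]
    refine mul_le_mul_of_nonneg_right ?_ (mul_nonneg hπ0 hL)
    by_contra! hlt
    refine hmem fun j => ?_
    beta_reduce
    by_cases hj : j = i
    · subst hj
      rw [if_pos rfl]
      refine ⟨hp j, fun hb => ?_⟩
      rw [Metric.mem_closedBall, Prod.dist_eq, max_le_iff, Real.dist_eq] at hb
      exact absurd hb.1 (not_le.2 hlt)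
    · rw [if_neg hj]
      exact hp j

theorem abs_setIntegral_mean_sub_le (hπ : IsAdmissiblePrior μ σ π₀) {i : Fin k} {δ C : ℝ}
    (hδ : 0 ≤ δ) (hC : ∀ p ∈ paramSpace k, π₀ p ≤ C) {m s : Fin k → ℝ} {N : Fin k → ℕ}
    (hs : ∀ j, 0 < s j) (hN : ∀ j, 8 ≤ N j)
    (henv : ∀ j, IntegrableOn (envelope (m j) (s j)) halfPlane) :
    |(∫ p in paramSpace k, p.1 i * (π₀ p * relLikelihood m s N p)) -
        μ i * ∫ p in paramSpace k, π₀ p * relLikelihood m s N p| ≤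
      δ * (∫ p in paramSpace k, π₀ p * relLikelihood m s N p) +
      C * (1 + |μ i|) * ∏ j,
        ∫ z in if j = i then halfPlane \ Metric.closedBall (μ j, σ j ^ 2) δ else halfPlane,
          (if j = i then 1 + |z.1| else 1) * Real.exp (-(N j * gaussLoss (m j) (s j) z)) := by
  have h1 := integrableOn_mul_relLikelihood (m := m) (N := N) hs hπ.integrableOn
  have h2 := integrableOn_mean_mul_relLikelihood hs hN henv hπ.integrableOn hπ.nonneg hC i
  have hmeas : MeasurableSet (boxSet fun j => if j = i then
      halfPlane \ Metric.closedBall (μ j, σ j ^ 2) δ else halfPlane) := by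
    refine measurableSet_boxSet fun j => ?_
    split_ifs
    · exact measurableSet_halfPlane.diff measurableSet_closedBall
    · exact measurableSet_halfPlane
  have hsub : (boxSet fun j => if j = i then
      halfPlane \ Metric.closedBall (μ j, σ j ^ 2) δ else halfPlane) ⊆ paramSpace k := by
    rw [paramSpace_eq_boxSet]
    refine boxSet_mono fun j => ?_
    split_ifs
    · exact sdiff_subset
    · exact subset_rfl
  have h3 : IntegrableOn (fun p : Param k => C * (1 + |μ i|) *
      ∏ j, (if j = i then 1 + |p.1 j| else 1) *
        Real.exp (-(N j * gaussLoss (m j) (s j) (p.1 j, p.2 j)))) (paramSpace k) := by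
    refine Integrable.const_mul ?_ _
    refine integrableOn_boxSet (A := fun _ => halfPlane) (f := fun j z =>
      (if j = i then 1 + |z.1| else 1) * Real.exp (-(N j * gaussLoss (m j) (s j) z))) fun j => ?_
    by_cases hj : j = i
    · simp only [if_pos hj]
      exact integrableOn_one_add_abs_mul_exp (hs j) (hN j) (henv j)
    · simp only [if_neg hj, one_mul]
      exact integrableOn_exp_halfPlane (hs j) (hN j) (henv j)
  rw [← integral_const_mul, ← integral_sub h2 (h1.const_mul _)]
  refine (abs_integral_le_integral_abs).trans ?_
  calc _ ≤ ∫ p in paramSpace k, (δ * (π₀ p * relLikelihood m s N p) +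
        (boxSet fun j => if j = i then halfPlane \ Metric.closedBall (μ j, σ j ^ 2) δ
          else halfPlane).indicator (fun p => C * (1 + |μ i|) *
            ∏ j, (if j = i then 1 + |p.1 j| else 1) *
              Real.exp (-(N j * gaussLoss (m j) (s j) (p.1 j, p.2 j)))) p) := by
        refine setIntegral_mono_on (h2.sub (h1.const_mul _)).abs
          ((h1.const_mul _).add (h3.indicator hmeas)) (measurableSet_paramSpace k) fun p hp => ?_
        rw [← sub_mul, abs_mul, abs_of_nonneg (mul_nonneg (hπ.nonneg p hp)
          (relLikelihood_nonneg p))]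
        exact abs_mean_sub_mul_le hδ (hπ.nonneg p hp) (hC p hp) hp
    _ = _ := by
        rw [integral_add (h1.const_mul _) (h3.indicator hmeas), integral_const_mul,
          integral_indicator hmeas, Measure.restrict_restrict hmeas, inter_eq_left.2 hsub,
          integral_const_mul]
        congr 2
        exact setIntegral_boxSet _ fun j z =>
          (if j = i then 1 + |z.1| else 1) * Real.exp (-(N j * gaussLoss (m j) (s j) z))

/-- Posterior means are consistent as soon as all sample sizes tend to infinity. -/
theorem tendsto_relLikelihood_mean (hσ : ∀ j, 0 < σ j) (hπ : IsAdmissiblePrior μ σ π₀)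
    (hθ : ∀ j, Tendsto (fun n => (m n j, s n j)) atTop (𝓝 (μ j, σ j ^ 2)))
    (hN : ∀ j, Tendsto (fun n => N n j) atTop atTop) (i : Fin k) :
    Tendsto (fun n => (∫ p in paramSpace k, p.1 i * (π₀ p * relLikelihood (m n) (s n) (N n) p)) /
      ∫ p in paramSpace k, π₀ p * relLikelihood (m n) (s n) (N n) p) atTop (𝓝 (μ i)) := by
  obtain ⟨ρ₀, hρ₀, hρσ, c, hc, hev⟩ := exists_prod_le_evidence (N := N) hσ hπ hθ
  obtain ⟨M, -, hreg⟩ := eventually_regular hσ hθ hN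
  obtain ⟨C, hC0, hC⟩ := hπ.bounded_above
  rw [Metric.tendsto_nhds]
  intro ε hε
  set δ := min ρ₀ (ε / 2) with hδdef
  have hδ : 0 < δ := lt_min hρ₀ (half_pos hε)
  have hδσ : ∀ j, δ < σ j ^ 2 := fun j => (min_le_left _ _).trans_lt (hρσ j)
  -- The comparison with the evidence is made design by design: the `N_j` may grow at different
  -- speeds, so an error `exp (ε * N_j)` of a fast design could swamp the decay in `N_i`. The `i`-th
  -- ratio tends to 0, the others to 1.
  have hlim : Tendsto (fun n => C * (1 + |μ i|) / c * ∏ j,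
      ((∫ z in if j = i then halfPlane \ Metric.closedBall (μ j, σ j ^ 2) δ else halfPlane,
          (if j = i then 1 + |z.1| else 1) *
            Real.exp (-(N n j * gaussLoss (m n j) (s n j) z))) /
        ∫ z in Metric.closedBall (μ j, σ j ^ 2) δ,
          Real.exp (-(N n j * gaussLoss (m n j) (s n j) z)))) atTop (𝓝 0) := by
    have h0 : (0 : ℝ) = C * (1 + |μ i|) / c * ∏ j, if j = i then (0 : ℝ) else 1 := by
      have hz : (∏ j, if j = i then (0 : ℝ) else 1) = 0 :=
        Finset.prod_eq_zero (Finset.mem_univ i) (by simp)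
      rw [hz, mul_zero]
    rw [h0]
    refine Tendsto.const_mul _ (tendsto_finsetProd _ fun j _ => ?_)
    by_cases hj : j = i
    · simp only [if_pos hj]
      exact tendsto_ratio_diff_closedBall (N := fun n => N n j) (pow_pos (hσ j) 2) (hθ j) (hN j)
        hδ (hδσ j)
    · simp only [if_neg hj, one_mul]
      exact tendsto_ratio_closedBall (N := fun n => N n j) (pow_pos (hσ j) 2) (hθ j) (hN j)
        hδ (hδσ j)
  filter_upwards [hev δ (min_le_left _ _), hreg,
    eventually_prod_setIntegral_closedBall_pos (N := N) hσ hθ hδ hδσ,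
    hlim.eventually (gt_mem_nhds (half_pos hε))] with n h1 h2 h3 h4
  obtain ⟨hs, h8, henv, -⟩ := h2
  set J := ∫ p in paramSpace k, π₀ p * relLikelihood (m n) (s n) (N n) p
  have hJ : 0 < J := (mul_pos hc h3).trans_le h1
  have h5 := abs_setIntegral_mean_sub_le hπ (i := i) hδ.le hC hs h8 henv
  rw [Finset.prod_div_distrib] at h4
  set T := ∏ j, ∫ z in if j = i then halfPlane \ Metric.closedBall (μ j, σ j ^ 2) δ
    else halfPlane, (if j = i then 1 + |z.1| else 1) *
      Real.exp (-(N n j * gaussLoss (m n j) (s n j) z)) with hT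
  set D := ∏ j, ∫ z in Metric.closedBall (μ j, σ j ^ 2) δ,
          Real.exp (-(N n j * gaussLoss (m n j) (s n j) z))
  rw [Real.dist_eq, div_sub' hJ.ne', abs_div, abs_of_pos hJ, div_lt_iff₀ hJ]
  have h6 : C * (1 + |μ i|) * T < ε / 2 * J := by
    have : C * (1 + |μ i|) / c * (T / D) = C * (1 + |μ i|) * T / (c * D) := by
      field_simp
    rw [this, div_lt_iff₀ (by positivity)] at h4
    exact h4.trans_le (by gcongr)
  have h7 : δ * J ≤ ε / 2 * J := by
    gcongr
    exact min_le_right _ _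
  rw [mul_comm J (μ i)]
  linarith

end

/-! ### The pairwise rate and the loss on the event of a wrong order -/

/-- Take for `φ` the projection of `x` to `[a, b]`. With sample means `a ≤ b` and parameters `y ≤ x`
in the wrong order, a common mean is no farther from either. -/
theorem exists_mem_Icc_abs_sub_le {a b x y : ℝ} (hab : a ≤ b) (hyx : y ≤ x) :
    ∃ φ ∈ Icc a b, |a - φ| ≤ |a - x| ∧ |b - φ| ≤ |b - y| := by
  rcases le_total x a with hxa | hxa
  · refine ⟨a, ⟨le_rfl, hab⟩, by simp, ?_⟩
    rw [abs_of_nonneg (by linarith), abs_of_nonneg (by linarith)]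
    linarith
  rcases le_total x b with hxb | hxb
  · refine ⟨x, ⟨hxa, hxb⟩, le_rfl, ?_⟩
    rw [abs_of_nonneg (by linarith), abs_of_nonneg (by linarith)]
    linarith
  · refine ⟨b, ⟨hab, le_rfl⟩, ?_, by simp⟩
    rw [abs_of_nonpos (by linarith), abs_of_nonpos (by linarith)]
    linarith

theorem half_mul_log_le_of_abs_le {a c s x y : ℝ} (ha : 0 ≤ a) (hs : 0 < s)
    (h : |c - x| ≤ |c - y|) :
    a / 2 * Real.log (1 + (c - x) ^ 2 / s) ≤ a / 2 * Real.log (1 + (c - y) ^ 2 / s) := by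
  have h2 : (c - x) ^ 2 ≤ (c - y) ^ 2 := sq_le_sq.2 h
  gcongr

theorem eventually_forall_half_mul_log_le {K : Set ℝ} (hK : IsCompact K) {a m s : ℕ → ℝ}
    {α μ v : ℝ} (hv : 0 < v) (ha : Tendsto a atTop (𝓝 α))
    (hθ : Tendsto (fun n => (m n, s n)) atTop (𝓝 (μ, v))) {ε : ℝ} (hε : 0 < ε) :
    ∀ᶠ n in atTop, ∀ φ ∈ K, α / 2 * Real.log (1 + (μ - φ) ^ 2 / v) - ε ≤
      a n / 2 * Real.log (1 + (m n - φ) ^ 2 / s n) := by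
  have hall : Tendsto (fun n => (a n, m n, s n)) atTop (𝓝 (α, μ, v)) := ha.prodMk_nhds hθ
  have key : ∀ᶠ q : ℝ × ℝ × ℝ in 𝓝 (α, μ, v), ∀ φ ∈ K,
      α / 2 * Real.log (1 + (μ - φ) ^ 2 / v) - ε ≤
        q.1 / 2 * Real.log (1 + (q.2.1 - φ) ^ 2 / q.2.2) := by
    refine hK.eventually_forall_of_forall_eventually fun φ _ => ?_
    have hv' : v ≠ 0 := hv.ne'
    have hpos : 1 + (μ - φ) ^ 2 / v ≠ 0 := by positivity
    have hc : ContinuousAt (fun z : (ℝ × ℝ × ℝ) × ℝ =>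
        z.1.1 / 2 * Real.log (1 + (z.1.2.1 - z.2) ^ 2 / z.1.2.2) -
        (α / 2 * Real.log (1 + (μ - z.2) ^ 2 / v) - ε)) ((α, μ, v), φ) := by
      fun_prop (disch := assumption)
    have h0 := hc.eventually (lt_mem_nhds (a := 0) (by simpa using hε))
    exact h0.mono fun z hz => by linarith
  exact hall.eventually key

section Rate

variable {k : ℕ} {μ σ α : Fin k → ℝ}

theorem exists_rateObjective_le (hσ : ∀ j, 0 < σ j) (hα : ∀ j, 0 ≤ α j) {b i : Fin k}
    (hib : μ i ≤ μ b) :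
    ∃ φ ∈ Icc (μ i) (μ b), ∀ x, rateObjective μ σ α b i φ ≤ rateObjective μ σ α b i x := by
  have hcont : ContinuousOn (rateObjective μ σ α b i) (Icc (μ i) (μ b)) := by
    have h1 : ∀ j x, 1 + (μ j - x) ^ 2 / σ j ^ 2 ≠ 0 := fun j x => by positivity
    unfold rateObjective
    refine Continuous.continuousOn ?_
    refine .add (.mul continuous_const (.log (by fun_prop) (h1 i)))
      (.mul continuous_const (.log (by fun_prop) (h1 b)))
  obtain ⟨φ, hφ, hmin⟩ := isCompact_Icc.exists_isMinOn (nonempty_Icc.2 hib) hcont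
  refine ⟨φ, hφ, fun x => ?_⟩
  -- Clamping `x` to the interval does not increase the objective, so a minimum over the compact
  -- interval is global.
  obtain ⟨y, hy, h1, h2⟩ := exists_mem_Icc_abs_sub_le hib (le_refl x)
  refine (hmin hy).trans (add_le_add ?_ ?_)
  · exact half_mul_log_le_of_abs_le (hα i) (pow_pos (hσ i) 2) h1
  · exact half_mul_log_le_of_abs_le (hα b) (pow_pos (hσ b) 2) h2

theorem exists_pairRate_eq (hσ : ∀ j, 0 < σ j) (hα : ∀ j, 0 ≤ α j) {b i : Fin k}
    (hib : μ i ≤ μ b) :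
    ∃ φ ∈ Icc (μ i) (μ b), pairRate μ σ α b i = rateObjective μ σ α b i φ ∧
      ∀ x, rateObjective μ σ α b i φ ≤ rateObjective μ σ α b i x := by
  obtain ⟨φ, hφ, h⟩ := exists_rateObjective_le hσ hα hib
  exact ⟨φ, hφ, le_antisymm (ciInf_le ⟨_, forall_mem_range.2 h⟩ φ) (le_ciInf h), h⟩

variable {π₀ : Param k → ℝ} {m s : ℕ → Fin k → ℝ} {N : ℕ → Fin k → ℕ}

/-- On the event that `b` is not better than `i`, the weighted loss is at least the pairwise rate,
up to an arbitrarily small error. -/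
theorem eventually_pairRate_le_sum_gaussLoss (hσ : ∀ j, 0 < σ j) (hα : ∀ j, 0 ≤ α j)
    (hθ : ∀ j, Tendsto (fun n => (m n j, s n j)) atTop (𝓝 (μ j, σ j ^ 2)))
    (hN : ∀ j, Tendsto (fun n => N n j) atTop atTop)
    (hNα : ∀ j, Tendsto (fun n => (N n j : ℝ) / n) atTop (𝓝 (α j)))
    {b i : Fin k} (hib : μ i < μ b) {ε : ℝ} (hε : 0 < ε) :
    ∀ᶠ n in atTop, ∀ p ∈ paramSpace k, p.1 b ≤ p.1 i →
      n * (pairRate μ σ α b i - ε) ≤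
        ∑ j, ((N n j : ℝ) - 8) * gaussLoss (m n j) (s n j) (p.1 j, p.2 j) := by
  have hne : i ≠ b := fun h => by simp [h] at hib
  obtain ⟨φ₀, -, hrate, hmin⟩ := exists_pairRate_eq hσ hα hib.le
  have hv : ∀ j, 0 < σ j ^ 2 := fun j => pow_pos (hσ j) 2
  have hs : ∀ j, Tendsto (fun n => s n j) atTop (𝓝 (σ j ^ 2)) := fun j =>
    (continuous_snd.tendsto _).comp (hθ j)
  have hm : ∀ j, Tendsto (fun n => m n j) atTop (𝓝 (μ j)) := fun j =>
    (continuous_fst.tendsto _).comp (hθ j)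
  have ha : ∀ j, Tendsto (fun n => ((N n j : ℝ) - 8) / n) atTop (𝓝 (α j)) := by
    intro j
    have := (hNα j).sub (tendsto_const_div_atTop_nhds_zero_nat (8 : ℝ))
    simpa only [sub_zero, ← sub_div] using this
  -- The clamped mean lies between the sample means, hence only near `[μ i, μ b]`; the unit margin
  -- covers this.
  have hK : IsCompact (Icc (μ i - 1) (μ b + 1)) := isCompact_Icc
  filter_upwards [eventually_forall_half_mul_log_le hK (hv i) (ha i) (hθ i) (half_pos hε),
    eventually_forall_half_mul_log_le hK (hv b) (ha b) (hθ b) (half_pos hε),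
    eventually_all.2 fun j => (hs j).eventually (lt_mem_nhds (hv j)),
    eventually_all.2 fun j => (hN j).eventually_ge_atTop 8,
    (hm i).eventually (lt_mem_nhds (sub_one_lt (μ i))),
    (hm b).eventually (gt_mem_nhds (lt_add_one (μ b))),
    (hm i).eventually_lt (hm b) hib, eventually_gt_atTop 0] with
    n h1 h2 hsn hNn h3 h4 h5 hn p hp hpb
  have hn' : (0 : ℝ) < n := by exact_mod_cast hn
  have hNn' : ∀ j, (0 : ℝ) ≤ (N n j : ℝ) - 8 := fun j => by
    have : (8 : ℝ) ≤ N n j := by exact_mod_cast hNn j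
    linarith
  obtain ⟨φ, hφ, g1, g2⟩ := exists_mem_Icc_abs_sub_le h5.le hpb
  have hφK : φ ∈ Icc (μ i - 1) (μ b + 1) := ⟨h3.le.trans hφ.1, hφ.2.trans h4.le⟩
  have hterm : ∀ j, |m n j - φ| ≤ |m n j - p.1 j| →
      n * (((N n j : ℝ) - 8) / n / 2 * Real.log (1 + (m n j - φ) ^ 2 / s n j)) ≤
        ((N n j : ℝ) - 8) * gaussLoss (m n j) (s n j) (p.1 j, p.2 j) := by
    intro j hj
    calc _ = ((N n j : ℝ) - 8) / 2 * Real.log (1 + (m n j - φ) ^ 2 / s n j) := by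
          field_simp
      _ ≤ ((N n j : ℝ) - 8) / 2 * Real.log (1 + (m n j - p.1 j) ^ 2 / s n j) :=
          half_mul_log_le_of_abs_le (hNn' j) (hsn j) hj
      _ = ((N n j : ℝ) - 8) * (1 / 2 * Real.log (1 + (m n j - p.1 j) ^ 2 / s n j)) := by ring
      _ ≤ _ := mul_le_mul_of_nonneg_left
          (half_log_le_gaussLoss (z := (p.1 j, p.2 j)) (hsn j) (hp j)) (hNn' j)
  -- Losses of the other designs are nonnegative and are discarded.
  have hpair : ((N n i : ℝ) - 8) * gaussLoss (m n i) (s n i) (p.1 i, p.2 i) +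
      ((N n b : ℝ) - 8) * gaussLoss (m n b) (s n b) (p.1 b, p.2 b) ≤
      ∑ j, ((N n j : ℝ) - 8) * gaussLoss (m n j) (s n j) (p.1 j, p.2 j) := by
    rw [← Finset.sum_pair (f := fun j => ((N n j : ℝ) - 8) *
      gaussLoss (m n j) (s n j) (p.1 j, p.2 j)) hne]
    exact Finset.sum_le_sum_of_subset_of_nonneg (Finset.subset_univ _) fun j _ _ =>
      mul_nonneg (hNn' j) (gaussLoss_nonneg (hsn j) (hp j))
  refine le_trans ?_ hpair
  refine le_trans ?_ (add_le_add (hterm i g1) (hterm b g2))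
  rw [← mul_add]
  refine mul_le_mul_of_nonneg_left ?_ hn'.le
  have e1 := h1 φ hφK
  have e2 := h2 φ hφK
  have e3 := hmin φ
  rw [← hrate] at e3
  unfold rateObjective at e3
  linarith

/-! ### Exponential bounds for incorrect selection -/

/-- The parameters for which `b` is not strictly better than every other design. -/
def incorrectSet (b : Fin k) : Set (Param k) :=
  paramSpace k \ {p | ∀ i, i ≠ b → p.1 i < p.1 b}

theorem measurableSet_correct (b : Fin k) :
    MeasurableSet {p : Param k | ∀ i, i ≠ b → p.1 i < p.1 b} := by
  simp only [ofPred_forall]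
  refine MeasurableSet.iInter fun i => MeasurableSet.iInter fun _ => ?_
  exact measurableSet_lt (by fun_prop) (by fun_prop)

theorem measurableSet_incorrectSet (b : Fin k) : MeasurableSet (incorrectSet b) :=
  (measurableSet_paramSpace k).diff (measurableSet_correct b)

/-- Half of `ε` is spent on the loss in the numerator, half on the evidence; since the sample sizes
sum to `n`, the latter costs `exp (-n * ε / 2)` in total. -/
theorem exists_ratio_incorrectSet_le (hσ : ∀ j, 0 < σ j) (hπ : IsAdmissiblePrior μ σ π₀)
    (hα : ∀ j, 0 ≤ α j)
    (hθ : ∀ j, Tendsto (fun n => (m n j, s n j)) atTop (𝓝 (μ j, σ j ^ 2)))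
    (hNsum : ∀ n, ∑ j, N n j = n)
    (hN : ∀ j, Tendsto (fun n => N n j) atTop atTop)
    (hNα : ∀ j, Tendsto (fun n => (N n j : ℝ) / n) atTop (𝓝 (α j)))
    {b : Fin k} (hb : ∀ i, i ≠ b → μ i < μ b) {V : ℝ} (hV : ∀ i, i ≠ b → V ≤ pairRate μ σ α b i)
    {ε : ℝ} (hε : 0 < ε) :
    ∃ A > 0, ∀ᶠ n : ℕ in atTop,
      (∫ p in incorrectSet b, π₀ p * relLikelihood (m n) (s n) (N n) p) /
        (∫ p in paramSpace k, π₀ p * relLikelihood (m n) (s n) (N n) p) ≤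
      A * Real.exp (-(n * (V - ε))) := by
  obtain ⟨ρ, hρ, hρσ, c, hc, hev⟩ := exists_prod_le_evidence (N := N) hσ hπ hθ
  obtain ⟨M, hM, hreg⟩ := eventually_regular hσ hθ hN
  obtain ⟨C, hC0, hC⟩ := hπ.bounded_above
  choose w hw hwle using fun j => exists_mul_exp_le_setIntegral_closedBall
    (N := fun n => N n j) (pow_pos (hσ j) 2) (hθ j) hρ (hρσ j) (half_pos hε)
  have hW : 0 < ∏ j, w j := Finset.prod_pos fun j _ => hw j
  have hloss : ∀ᶠ n in atTop, ∀ i, i ≠ b → ∀ p ∈ paramSpace k, p.1 b ≤ p.1 i →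
      n * (pairRate μ σ α b i - ε / 2) ≤
        ∑ j, ((N n j : ℝ) - 8) * gaussLoss (m n j) (s n j) (p.1 j, p.2 j) := by
    refine eventually_all.2 fun i => ?_
    by_cases hi : i = b
    · simp [hi]
    · filter_upwards [eventually_pairRate_le_sum_gaussLoss hσ hα hθ hN hNα (hb i hi)
        (half_pos hε)] with n hn _ using hn
  refine ⟨C * M / (c * ∏ j, w j), by positivity, ?_⟩
  filter_upwards [hev ρ le_rfl, hreg, eventually_all.2 hwle, hloss] with n h1 h2 h3 h4
  obtain ⟨hs, h8, henv, hMn⟩ := h2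
  have hnum : ∫ p in incorrectSet b, π₀ p * relLikelihood (m n) (s n) (N n) p ≤
      C * Real.exp (-(n * (V - ε / 2))) * M := by
    refine (setIntegral_mul_relLikelihood_le h8 hs henv hπ.integrableOn hC0.le hC
      (measurableSet_incorrectSet b) sdiff_subset (R := n * (V - ε / 2)) fun p hp => ?_).trans ?_
    · obtain ⟨hpP, hpb⟩ := hp
      simp only [mem_ofPred_eq, not_forall, not_lt] at hpb
      obtain ⟨i, hi, hle⟩ := hpb
      refine le_trans ?_ (h4 i hi p hpP hle)
      exact mul_le_mul_of_nonneg_left (by linarith [hV i hi]) n.cast_nonneg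
    · exact mul_le_mul_of_nonneg_left hMn (by positivity)
  have hden : c * ((∏ j, w j) * Real.exp (-(n * (ε / 2)))) ≤
      ∫ p in paramSpace k, π₀ p * relLikelihood (m n) (s n) (N n) p := by
    refine le_trans (mul_le_mul_of_nonneg_left ?_ hc.le) h1
    have hsum : (n : ℝ) = ∑ j, (N n j : ℝ) := by exact_mod_cast (hNsum n).symm
    rw [hsum, Finset.sum_mul, ← Finset.sum_neg_distrib, Real.exp_sum, ← Finset.prod_mul_distrib]
    exact Finset.prod_le_prod (fun j _ => mul_nonneg (hw j).le (Real.exp_pos _).le)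
      fun j _ => h3 j
  calc _ ≤ C * Real.exp (-(n * (V - ε / 2))) * M / (c * ((∏ j, w j) * Real.exp (-(n * (ε / 2))))) :=
        div_le_div₀ (by positivity) hnum (by positivity) hden
    _ = C * M / (c * ∏ j, w j) * (Real.exp (-(n * (V - ε / 2))) / Real.exp (-(n * (ε / 2)))) := by
        field_simp
    _ = _ := by
        rw [← Real.exp_sub]
        ring_nf

theorem exists_le_setIntegral_incorrectSet (hσ : ∀ j, 0 < σ j) (hπ : IsAdmissiblePrior μ σ π₀)
    (hθ : ∀ j, Tendsto (fun n => (m n j, s n j)) atTop (𝓝 (μ j, σ j ^ 2)))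
    (hNsum : ∀ n, ∑ j, N n j = n) {b i : Fin k} (hib : i ≠ b)
    (φ : Fin k → ℝ) (hφ : ∀ j, φ j ∈ Icc (⨅ j, μ j) (⨆ j, μ j)) (hφb : φ i = φ b)
    {ε : ℝ} (hε : 0 < ε) :
    ∃ A > 0, ∀ᶠ n : ℕ in atTop,
      A * Real.exp (-(n * ε + ∑ j, N n j * (1 / 2 * Real.log (1 + (μ j - φ j) ^ 2 / σ j ^ 2)))) ≤
        ∫ p in incorrectSet b, π₀ p * relLikelihood (m n) (s n) (N n) p := by
  obtain ⟨ρ₀, hρ₀, hρσ, c, hc, hlow⟩ := hπ.exists_le_on_closedBall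
  have hv : ∀ j, 0 < σ j ^ 2 := fun j => pow_pos (hσ j) 2
  have hs : ∀ j, Tendsto (fun n => s n j) atTop (𝓝 (σ j ^ 2)) := fun j =>
    (continuous_snd.tendsto _).comp (hθ j)
  -- The variances are the profile minimisers, so design `j` costs exactly the logarithmic term.
  set z : Fin k → ℝ × ℝ := fun j => (φ j, σ j ^ 2 + (μ j - φ j) ^ 2) with hz
  have hzQ : ∀ j, z j ∈ halfPlane := fun j => by
    show 0 < σ j ^ 2 + (μ j - φ j) ^ 2
    have := hv j
    positivity
  have hzbox : ∀ j, (z j).1 ∈ Icc (⨅ j, μ j) (⨆ j, μ j) ∧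
      (z j).2 ∈ Icc (⨅ j, σ j ^ 2) ((⨆ j, σ j ^ 2) + ((⨆ j, μ j) - ⨅ j, μ j) ^ 2) := by
    intro j
    obtain ⟨⟨a1, a2⟩, a3, a4⟩ := true_mem_box (μ := μ) (σ := σ) j
    have h4 := le_ciSup (Set.finite_range fun j => σ j ^ 2).bddAbove j
    refine ⟨hφ j, a3.trans (le_add_of_nonneg_right (sq_nonneg _)), add_le_add h4 ?_⟩
    obtain ⟨b1, b2⟩ := hφ j
    exact sq_le_sq' (by linarith) (by linarith)
  choose δ hδ hδle using fun j => eventually_gaussLoss_le (μ := μ j) (hv j) (hzQ j) hε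
  obtain ⟨ρ, hρ, hρρ₀, hρδ⟩ : ∃ ρ > 0, ρ ≤ ρ₀ ∧ ∀ j, ρ ≤ δ j := by
    have : Nonempty (Fin k) := ⟨i⟩
    obtain ⟨j₀, hj₀⟩ := Finite.exists_min δ
    exact ⟨min ρ₀ (δ j₀), lt_min hρ₀ (hδ j₀), min_le_left _ _, fun j =>
      (min_le_right _ _).trans (hj₀ j)⟩
  -- Shifting the centre of `i` up and that of `b` down by `ρ / 2` makes the balls of radius `ρ / 2`
  -- satisfy `p.1 b ≤ φ b = φ i ≤ p.1 i`, while they stay within `ρ` of `z j`.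
  set τ : Fin k → ℝ := fun j => if j = i then ρ / 2 else if j = b then -(ρ / 2) else 0 with hτ
  have hτρ : ∀ j, |τ j| ≤ ρ / 2 := by
    intro j
    simp only [hτ]
    split_ifs
    · rw [abs_of_pos (half_pos hρ)]
    · rw [abs_neg, abs_of_pos (half_pos hρ)]
    · rw [abs_zero]; exact (half_pos hρ).le
  set A : Fin k → Set (ℝ × ℝ) := fun j =>
    Metric.closedBall (φ j + τ j, σ j ^ 2 + (μ j - φ j) ^ 2) (ρ / 2) with hA
  have hAz : ∀ j, A j ⊆ Metric.closedBall (z j) ρ := by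
    intro j
    refine Metric.closedBall_subset_closedBall' ?_
    rw [hz, Prod.dist_eq, dist_self, Real.dist_eq, add_sub_cancel_left,
      max_eq_left (abs_nonneg _)]
    linarith [hτρ j]
  have hσz : ∀ j, ρ < (z j).2 := fun j => hρρ₀.trans_lt (hρσ.trans_le (hzbox j).2.1)
  have hAQ : ∀ j, A j ⊆ halfPlane := fun j =>
    (hAz j).trans (closedBall_subset_halfPlane (hσz j))
  have hAfin : ∀ j, volume (A j) ≠ ⊤ := fun j => measure_closedBall_lt_top.ne
  have hAS : boxSet A ⊆ incorrectSet b := by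
    intro p hp
    refine ⟨boxSet_mono hAQ hp, fun hcor => ?_⟩
    have h1 := hcor i hib
    have hi := hp i
    have hb := hp b
    simp only [hA, hτ, Metric.mem_closedBall, Prod.dist_eq, max_le_iff, Real.dist_eq, if_true,
      if_neg hib.symm, abs_le] at hi hb
    linarith [hi.1.1, hb.1.2]
  refine ⟨c * ∏ j, volume.real (A j), mul_pos hc (Finset.prod_pos fun j _ =>
    ENNReal.toReal_pos (Metric.measure_closedBall_pos _ _ (half_pos hρ)).ne' (hAfin j)), ?_⟩
  filter_upwards [eventually_all.2 fun j => (hθ j).eventually (hδle j),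
    eventually_all.2 fun j => (hs j).eventually (lt_mem_nhds (hv j))] with n h1 hsn
  refine le_trans ?_ (prod_le_setIntegral_mul_relLikelihood hsn hπ.integrableOn hπ.nonneg
    (fun j => measurableSet_closedBall) hAfin hAQ (c := c) (fun p hp => hlow z hzbox p
      (boxSet_mono (fun j => (hAz j).trans (Metric.closedBall_subset_closedBall hρρ₀)) hp))
    (measurableSet_incorrectSet b) sdiff_subset hAS)
  have hsum : (n : ℝ) = ∑ j, (N n j : ℝ) := by exact_mod_cast (hNsum n).symm
  rw [mul_assoc, hsum, Finset.sum_mul, ← Finset.sum_add_distrib, ← Finset.sum_neg_distrib,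
    Real.exp_sum, ← Finset.prod_mul_distrib]
  refine mul_le_mul_of_nonneg_left (Finset.prod_le_prod (fun j _ => by positivity) fun j _ => ?_)
    hc.le
  refine le_trans (le_of_eq ?_) (mul_exp_le_setIntegral_exp_gaussLoss measurableSet_closedBall
    (hAQ j) (hAfin j) (m := m n j) (hsn j) (N n j)
    (r := ε + 1 / 2 * Real.log (1 + (μ j - φ j) ^ 2 / σ j ^ 2)) fun w hw => ?_)
  · rw [mul_add]
  · have h2 := h1 j w ((hAz j hw).trans (hρδ j))
    rw [hz, gaussLoss_profile (hv j)] at h2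
    linarith

theorem exists_le_ratio_incorrectSet (hσ : ∀ j, 0 < σ j) (hπ : IsAdmissiblePrior μ σ π₀)
    (hα : ∀ j, 0 ≤ α j)
    (hθ : ∀ j, Tendsto (fun n => (m n j, s n j)) atTop (𝓝 (μ j, σ j ^ 2)))
    (hNsum : ∀ n, ∑ j, N n j = n)
    (hN : ∀ j, Tendsto (fun n => N n j) atTop atTop)
    (hNα : ∀ j, Tendsto (fun n => (N n j : ℝ) / n) atTop (𝓝 (α j)))
    {b i : Fin k} (hib : μ i < μ b) {ε : ℝ} (hε : 0 < ε) :
    ∃ A > 0, ∀ᶠ n : ℕ in atTop, A * Real.exp (-(n * (pairRate μ σ α b i + ε))) ≤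
      (∫ p in incorrectSet b, π₀ p * relLikelihood (m n) (s n) (N n) p) /
        ∫ p in paramSpace k, π₀ p * relLikelihood (m n) (s n) (N n) p := by
  have hne : i ≠ b := fun h => by simp [h] at hib
  obtain ⟨M, hM, hreg⟩ := eventually_regular hσ hθ hN
  obtain ⟨C, hC0, hC⟩ := hπ.bounded_above
  obtain ⟨φ₀, hφ₀, hrate, -⟩ := exists_pairRate_eq hσ hα hib.le
  -- Designs `i` and `b` share the minimiser of the rate; all others keep their true means and cost
  -- nothing.
  set φ : Fin k → ℝ := fun j => if j = i ∨ j = b then φ₀ else μ j with hφdef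
  have hφ : ∀ j, φ j ∈ Icc (⨅ j, μ j) (⨆ j, μ j) := by
    intro j
    simp only [hφdef]
    split_ifs
    · exact ⟨(ciInf_le (Set.finite_range μ).bddBelow i).trans hφ₀.1,
        hφ₀.2.trans (le_ciSup (Set.finite_range μ).bddAbove b)⟩
    · exact ⟨ciInf_le (Set.finite_range μ).bddBelow j, le_ciSup (Set.finite_range μ).bddAbove j⟩
  obtain ⟨A, hA, hnum⟩ := exists_le_setIntegral_incorrectSet (m := m) (s := s) (N := N) hσ hπ hθ
    hNsum hne φ hφ (by simp [hφdef]) (half_pos hε)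
  have hlim : Tendsto (fun n : ℕ => ∑ j, (N n j : ℝ) / n *
      (1 / 2 * Real.log (1 + (μ j - φ j) ^ 2 / σ j ^ 2))) atTop (𝓝 (pairRate μ σ α b i)) := by
    have h : pairRate μ σ α b i =
        ∑ j, α j * (1 / 2 * Real.log (1 + (μ j - φ j) ^ 2 / σ j ^ 2)) := by
      rw [← Finset.sum_subset (Finset.subset_univ {i, b}), Finset.sum_pair hne, hrate,
        rateObjective]
      · simp only [hφdef, true_or, or_true, if_true]
        ring
      · intro j _ hj
        simp only [Finset.mem_insert, Finset.mem_singleton] at hj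
        simp [hφdef, hj]
    rw [h]
    exact tendsto_finsetSum _ fun j _ => (hNα j).mul_const _
  refine ⟨A / (C * M), by positivity, ?_⟩
  filter_upwards [hnum, hreg, hlim.eventually (gt_mem_nhds (lt_add_of_pos_right _ (half_pos hε))),
    eventually_gt_atTop 0, eventually_evidence_pos (N := N) hσ hπ hθ] with n h1 h2 h3 hn hJ
  obtain ⟨hs, h8, henv, hMn⟩ := h2
  have hn' : (0 : ℝ) < n := by exact_mod_cast hn
  have hden : ∫ p in paramSpace k, π₀ p * relLikelihood (m n) (s n) (N n) p ≤ C * M := by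
    refine (setIntegral_mul_relLikelihood_le h8 hs henv hπ.integrableOn hC0.le hC
      (measurableSet_paramSpace k) subset_rfl (R := 0) fun p hp => ?_).trans ?_
    · refine Finset.sum_nonneg fun j _ => mul_nonneg ?_ (gaussLoss_nonneg (hs j) (hp j))
      have : (8 : ℝ) ≤ N n j := by exact_mod_cast h8 j
      linarith
    · rw [neg_zero, Real.exp_zero, mul_one]
      exact mul_le_mul_of_nonneg_left hMn hC0.le
  have hexp : A * Real.exp (-(n * (pairRate μ σ α b i + ε))) ≤
      ∫ p in incorrectSet b, π₀ p * relLikelihood (m n) (s n) (N n) p := by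
    refine le_trans (mul_le_mul_of_nonneg_left (Real.exp_le_exp.2 (neg_le_neg ?_)) hA.le) h1
    have h5 : ∑ j, (N n j : ℝ) * (1 / 2 * Real.log (1 + (μ j - φ j) ^ 2 / σ j ^ 2)) =
        n * ∑ j, (N n j : ℝ) / n * (1 / 2 * Real.log (1 + (μ j - φ j) ^ 2 / σ j ^ 2)) := by
      rw [Finset.mul_sum]
      exact Finset.sum_congr rfl fun j _ => by field_simp
    rw [h5, ← mul_add]
    exact mul_le_mul_of_nonneg_left (by linarith) hn'.le
  rw [div_mul_eq_mul_div]
  exact div_le_div₀ ((by positivity : (0 : ℝ) ≤ _).trans hexp) hexp hJ hden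

end Rate

/-! ### From exponential bounds to the limit, and back to the posterior -/

theorem tendsto_neg_inv_mul_log {r : ℕ → ℝ} {V : ℝ}
    (hupper : ∀ ε > 0, ∃ A > 0, ∀ᶠ n : ℕ in atTop, r n ≤ A * Real.exp (-(n * (V - ε))))
    (hlower : ∀ ε > 0, ∃ A > 0, ∀ᶠ n : ℕ in atTop, A * Real.exp (-(n * (V + ε))) ≤ r n) :
    Tendsto (fun n : ℕ => -(1 / (n : ℝ)) * Real.log (r n)) atTop (𝓝 V) := by
  rw [Metric.tendsto_nhds]
  intro ε hε
  obtain ⟨A, hA, h1⟩ := hupper (ε / 2) (half_pos hε)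
  obtain ⟨B, hB, h2⟩ := hlower (ε / 2) (half_pos hε)
  have hAl := (tendsto_const_div_atTop_nhds_zero_nat (Real.log A)).eventually
    (gt_mem_nhds (half_pos hε))
  have hBl := (tendsto_const_div_atTop_nhds_zero_nat (Real.log B)).eventually
    (lt_mem_nhds (neg_lt_zero.2 (half_pos hε)))
  filter_upwards [h1, h2, hAl, hBl, eventually_gt_atTop 0] with n g1 g2 g3 g4 hn
  have hn' : (0 : ℝ) < n := by exact_mod_cast hn
  have hB' : 0 < B * Real.exp (-(n * (V + ε / 2))) := by positivity
  have hr : 0 < r n := hB'.trans_le g2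
  have l1 := Real.log_le_log hr g1
  have l2 := Real.log_le_log hB' g2
  rw [Real.log_mul hA.ne' (Real.exp_pos _).ne', Real.log_exp] at l1
  rw [Real.log_mul hB.ne' (Real.exp_pos _).ne', Real.log_exp] at l2
  rw [div_lt_iff₀ hn'] at g3
  rw [lt_div_iff₀ hn'] at g4
  have e : -(1 / (n : ℝ)) * Real.log (r n) = -Real.log (r n) / n := by ring
  rw [Real.dist_eq, e, abs_lt]
  constructor
  · rw [lt_sub_iff_add_lt, lt_div_iff₀ hn']
    nlinarith
  · rw [sub_lt_iff_lt_add, div_lt_iff₀ hn']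
    nlinarith

section Posterior

variable {k : ℕ} {μ σ : Fin k → ℝ} {π₀ : Param k → ℝ} {x : Fin k → ℕ → ℝ} {m s : Fin k → ℝ}
  {N : Fin k → ℕ}

/-- The maximum `K` of the likelihood cancels against the evidence. -/
theorem posterior_eq_of_likelihood {K : ℝ} (hK : 0 < K)
    (hL : ∀ p ∈ paramSpace k, likelihood x N p = K * relLikelihood m s N p)
    {p : Param k} (hp : p ∈ paramSpace k) :
    posterior π₀ x N p = π₀ p * relLikelihood m s N p /
      ∫ p in paramSpace k, π₀ p * relLikelihood m s N p := by
  have hev : evidence π₀ x N = K * ∫ p in paramSpace k, π₀ p * relLikelihood m s N p := by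
    rw [evidence, ← integral_const_mul]
    exact setIntegral_congr_fun (measurableSet_paramSpace k) fun p hp => by
      simp only [hL p hp]; ring
  rw [_root_.posterior, hev, hL p hp, mul_left_comm, mul_div_mul_left _ _ hK.ne']

theorem posteriorMean_eq {K : ℝ} (hK : 0 < K)
    (hL : ∀ p ∈ paramSpace k, likelihood x N p = K * relLikelihood m s N p) (i : Fin k) :
    posteriorMean π₀ x N i = (∫ p in paramSpace k, p.1 i * (π₀ p * relLikelihood m s N p)) /
      ∫ p in paramSpace k, π₀ p * relLikelihood m s N p := by
  rw [posteriorMean, ← integral_div]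
  exact setIntegral_congr_fun (measurableSet_paramSpace k) fun p hp => by
    simp only [posterior_eq_of_likelihood hK hL hp, mul_div_assoc]

theorem one_sub_bayesPCS_eq {K : ℝ} (hK : 0 < K)
    (hL : ∀ p ∈ paramSpace k, likelihood x N p = K * relLikelihood m s N p)
    (hint : IntegrableOn (fun p => π₀ p * relLikelihood m s N p) (paramSpace k))
    (hJ : 0 < ∫ p in paramSpace k, π₀ p * relLikelihood m s N p) (b : Fin k) :
    1 - bayesPCS π₀ x N b = (∫ p in incorrectSet b, π₀ p * relLikelihood m s N p) /
      ∫ p in paramSpace k, π₀ p * relLikelihood m s N p := by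
  have h1 : bayesPCS π₀ x N b =
      (∫ p in paramSpace k ∩ {p | ∀ i, i ≠ b → p.1 i < p.1 b}, π₀ p * relLikelihood m s N p) /
        ∫ p in paramSpace k, π₀ p * relLikelihood m s N p := by
    rw [bayesPCS, ← integral_div]
    exact setIntegral_congr_fun ((measurableSet_paramSpace k).inter (measurableSet_correct b))
      fun p hp => posterior_eq_of_likelihood hK hL hp.1
  have h2 := integral_inter_add_sdiff (measurableSet_correct b) hint
  rw [h1, eq_div_iff hJ.ne', sub_mul, one_mul, div_mul_cancel₀ _ hJ.ne', incorrectSet]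
  linarith

theorem posteriorWellDefined_of_likelihood {K : ℝ} (hK : 0 < K)
    (hL : ∀ p ∈ paramSpace k, likelihood x N p = K * relLikelihood m s N p)
    (hint : IntegrableOn (fun p => π₀ p * relLikelihood m s N p) (paramSpace k))
    (hmean : ∀ i, IntegrableOn (fun p => p.1 i * (π₀ p * relLikelihood m s N p)) (paramSpace k))
    (hJ : 0 < ∫ p in paramSpace k, π₀ p * relLikelihood m s N p) :
    PosteriorWellDefined π₀ x N := by
  have hpt : ∀ p ∈ paramSpace k, K * (π₀ p * relLikelihood m s N p) = π₀ p * likelihood x N p :=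
    fun p hp => by rw [hL p hp]; ring
  refine ⟨IntegrableOn.congr_fun (hint.const_mul K) hpt (measurableSet_paramSpace k), ?_, fun i => ?_⟩
  · rw [evidence, ← setIntegral_congr_fun (measurableSet_paramSpace k) hpt, integral_const_mul]
    exact mul_pos hK hJ
  · refine IntegrableOn.congr_fun ((hmean i).div_const
      (∫ p in paramSpace k, π₀ p * relLikelihood m s N p)) (fun p hp => ?_)
      (measurableSet_paramSpace k)
    simp only [posterior_eq_of_likelihood hK hL hp, mul_div_assoc]

end Posterior

/-! ### The strong law for sample means and variances -/

section Sampling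

variable {Ω : Type*} [MeasurableSpace Ω] {P : Measure Ω} [IsProbabilityMeasure P]

/-- Strong consistency of the sample mean and variance of pairwise independent identically
distributed normal random variables. -/
theorem ae_tendsto_sampleMean_sampleVar {μ σ : ℝ} {X : ℕ → Ω → ℝ}
    (hX : ∀ l, HasLaw (X l) (gaussianReal μ (σ ^ 2).toNNReal) P)
    (hindep : Pairwise fun l l' => IndepFun (X l) (X l') P) :
    ∀ᵐ ω ∂P, Tendsto (fun n => (sampleMean (fun l => X l ω) n, sampleVar (fun l => X l ω) n))
      atTop (𝓝 (μ, σ ^ 2)) := by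
  have hmem : MemLp (id : ℝ → ℝ) 2 (gaussianReal μ (σ ^ 2).toNNReal) :=
    memLp_id_gaussianReal' 2 (by simp)
  have hid : ∀ l, IdentDistrib (X l) (X 0) P P := fun l => (hX l).identDistrib (hX 0)
  have hmemX : MemLp (X 0) 2 P := ((hX 0).identDistrib HasLaw.id).symm.memLp_snd hmem
  have h1 := strong_law_ae_real X (hmemX.integrable (by norm_num)) hindep hid
  -- The strong law used here needs only pairwise independence, which passes to the squares.
  have h2 := strong_law_ae_real (fun l ω => X l ω ^ 2) hmemX.integrable_sq
    (fun l l' hl => (hindep hl).comp (φ := fun y : ℝ => y ^ 2) (ψ := fun y : ℝ => y ^ 2)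
      (by fun_prop) (by fun_prop))
    (fun l => (hid l).comp (u := fun y : ℝ => y ^ 2) (by fun_prop))
  have hE : P[X 0] = μ := by rw [(hX 0).integral_eq, integral_id_gaussianReal]
  have hVar : Var[X 0; P] = σ ^ 2 := by
    rw [(hX 0).variance_eq, variance_id_gaussianReal, Real.coe_toNNReal _ (sq_nonneg σ)]
  have hE2 : ∫ ω, X 0 ω ^ 2 ∂P = σ ^ 2 + μ ^ 2 := by
    have h := variance_eq_sub hmemX
    rw [hVar, hE] at h
    have h' : P[X 0 ^ 2] = ∫ ω, X 0 ω ^ 2 ∂P := rfl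
    linarith
  rw [hE] at h1
  rw [hE2] at h2
  filter_upwards [h1, h2] with ω g1 g2
  refine Tendsto.prodMk_nhds g1 ?_
  have := g2.sub (g1.pow 2)
  rwa [add_sub_cancel_right] at this

end Sampling

/-! ### The main theorem -/

theorem theorem1 {k : ℕ} (hk : 2 ≤ k)
    {Ω : Type*} [MeasurableSpace Ω] (P : Measure Ω) [IsProbabilityMeasure P]
    -- true means and standard deviations, with a unique best design
    (μ σ : Fin k → ℝ) (hσ : ∀ i, 0 < σ i)
    (istar : Fin k) (hstar : ∀ i, i ≠ istar → μ i < μ istar)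
    -- independent normal observations
    (X : Fin k → ℕ → Ω → ℝ)
    (hX : ∀ i l, HasLaw (X i l) (gaussianReal (μ i) (σ i ^ 2).toNNReal) P)
    (hindep : Pairwise fun a b : Fin k × ℕ => IndepFun (X a.1 a.2) (X b.1 b.2) P)
    -- the prior density
    (π₀ : Param k → ℝ) (hπ : IsAdmissiblePrior μ σ π₀)
    -- the sample sizes for total budget `n`, with limiting proportions `α`
    (α : Fin k → ℝ) (N : ℕ → Fin k → ℕ)
    (hNsum : ∀ n, ∑ i, N n i = n)
    (hNtop : ∀ i, Tendsto (fun n => N n i) atTop atTop)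
    (hNα : ∀ i, Tendsto (fun n => (N n i : ℝ) / n) atTop (𝓝 (α i)))
    -- the selected design maximizes the posterior mean
    (best : ℕ → Ω → Fin k)
    (hbest : ∀ n ω j, posteriorMean π₀ (fun i l => X i l ω) (N n) j ≤
      posteriorMean π₀ (fun i l => X i l ω) (N n) (best n ω)) :
    (∀ i, i ≠ istar →
      IsLeast (range (rateObjective μ σ α istar i)) (pairRate μ σ α istar i)) ∧
    ∀ᵐ ω ∂P,
      (∀ᶠ n in atTop, PosteriorWellDefined π₀ (fun i l => X i l ω) (N n) ∧
        0 < 1 - bayesPCS π₀ (fun i l => X i l ω) (N n) (best n ω)) ∧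
      Tendsto
        (fun n : ℕ => -(1 / (n : ℝ)) *
          Real.log (1 - bayesPCS π₀ (fun i l => X i l ω) (N n) (best n ω)))
        atTop (𝓝 (⨅ i : {i : Fin k // i ≠ istar}, pairRate μ σ α istar i)) := by
  have hα : ∀ j, 0 ≤ α j := fun j =>
    ge_of_tendsto' (hNα j) fun n => div_nonneg (Nat.cast_nonneg _) (Nat.cast_nonneg _)
  refine ⟨fun i hi => ?_, ?_⟩
  · obtain ⟨φ, -, hφ, hmin⟩ := exists_pairRate_eq hσ hα (hstar i hi).le
    rw [hφ]
    exact ⟨mem_range_self φ, forall_mem_range.2 hmin⟩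
  have hne : Nonempty {i : Fin k // i ≠ istar} := by
    have : Nontrivial (Fin k) := Fin.nontrivial_iff_two_le.2 hk
    obtain ⟨i, hi⟩ := exists_ne istar
    exact ⟨⟨i, hi⟩⟩
  obtain ⟨i₀, hi₀⟩ := exists_eq_ciInf_of_finite
    (f := fun i : {i : Fin k // i ≠ istar} => pairRate μ σ α istar i)
  set V := ⨅ i : {i : Fin k // i ≠ istar}, pairRate μ σ α istar i with hVdef
  have hV : ∀ i, i ≠ istar → V ≤ pairRate μ σ α istar i := fun i hi =>
    ciInf_le (Set.finite_range _).bddBelow (⟨i, hi⟩ : {i : Fin k // i ≠ istar})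
  have hsamp := ae_all_iff.2 fun j => ae_tendsto_sampleMean_sampleVar (hX j)
    fun l l' hl => hindep (i := (j, l)) (j := (j, l')) fun h => hl (congrArg Prod.snd h)
  filter_upwards [hsamp] with ω hω
  have hθ : ∀ j, Tendsto (fun n => (sampleMean (fun l => X j l ω) (N n j),
      sampleVar (fun l => X j l ω) (N n j))) atTop (𝓝 (μ j, σ j ^ 2)) :=
    fun j => (hω j).comp (hNtop j)
  obtain ⟨C, hC0, hC⟩ := hπ.bounded_above
  obtain ⟨M, -, hreg⟩ := eventually_regular hσ hθ hNtop
  have hJ := eventually_evidence_pos (N := N) hσ hπ hθ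
  -- Consistency makes the true best design the strict maximiser eventually, so ties play no role in
  -- the limit.
  have hbest' : ∀ᶠ n in atTop, best n ω = istar := by
    have hlt : ∀ᶠ n in atTop, ∀ i, i ≠ istar → posteriorMean π₀ (fun i l => X i l ω) (N n) i <
        posteriorMean π₀ (fun i l => X i l ω) (N n) istar := by
      have hlim := tendsto_relLikelihood_mean hσ hπ hθ hNtop
      refine eventually_all.2 fun i => ?_
      by_cases hi : i = istar
      · simp [hi]
      filter_upwards [(hlim i).eventually_lt (hlim istar) (hstar i hi), hreg] with n h1 h2 _
      obtain ⟨K, hK, hL⟩ := exists_likelihood_eq (fun i l => X i l ω) (N n) h2.1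
      rwa [posteriorMean_eq hK hL, posteriorMean_eq hK hL]
    filter_upwards [hlt] with n hn
    by_contra hne
    exact absurd (hbest n ω istar) (not_le.2 (hn _ hne))
  have hPCS : ∀ᶠ n in atTop, PosteriorWellDefined π₀ (fun i l => X i l ω) (N n) ∧
      1 - bayesPCS π₀ (fun i l => X i l ω) (N n) (best n ω) =
      (∫ p in incorrectSet istar, π₀ p * relLikelihood
        (fun j => sampleMean (fun l => X j l ω) (N n j))
        (fun j => sampleVar (fun l => X j l ω) (N n j)) (N n) p) /
      ∫ p in paramSpace k, π₀ p * relLikelihood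
        (fun j => sampleMean (fun l => X j l ω) (N n j))
        (fun j => sampleVar (fun l => X j l ω) (N n j)) (N n) p := by
    filter_upwards [hbest', hreg, hJ] with n hb h2 h3
    obtain ⟨K, hK, hL⟩ := exists_likelihood_eq (fun i l => X i l ω) (N n) h2.1
    obtain ⟨hs, h8, henv, -⟩ := h2
    have hint := integrableOn_mul_relLikelihood
      (m := fun j => sampleMean (fun l => X j l ω) (N n j)) (N := N n) hs hπ.integrableOn
    rw [hb]
    exact ⟨posteriorWellDefined_of_likelihood hK hL hint (integrableOn_mean_mul_relLikelihood hs h8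
      henv hπ.integrableOn hπ.nonneg hC) h3, one_sub_bayesPCS_eq hK hL hint h3 istar⟩
  have hupper : ∀ ε > 0, ∃ A > 0, ∀ᶠ n : ℕ in atTop,
      1 - bayesPCS π₀ (fun i l => X i l ω) (N n) (best n ω) ≤
        A * Real.exp (-(n * (V - ε))) := by
    intro ε hε
    obtain ⟨A, hA, h⟩ := exists_ratio_incorrectSet_le hσ hπ hα hθ hNsum hNtop hNα hstar hV hε
    refine ⟨A, hA, ?_⟩
    filter_upwards [h, hPCS] with n h1 h2
    rwa [h2.2]
  have hlower : ∀ ε > 0, ∃ A > 0, ∀ᶠ n : ℕ in atTop, A * Real.exp (-(n * (V + ε))) ≤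
      1 - bayesPCS π₀ (fun i l => X i l ω) (N n) (best n ω) := by
    intro ε hε
    obtain ⟨A, hA, h⟩ := exists_le_ratio_incorrectSet hσ hπ hα hθ hNsum hNtop hNα
      (hstar i₀ i₀.2) hε
    rw [hi₀] at h
    refine ⟨A, hA, ?_⟩
    filter_upwards [h, hPCS] with n h1 h2
    rwa [h2.2]
  refine ⟨?_, tendsto_neg_inv_mul_log hupper hlower⟩
  -- Any exponential lower bound shows that the probability of incorrect selection is positive.
  obtain ⟨A, hA, h⟩ := hlower 1 one_pos
  filter_upwards [h, hPCS] with n h1 h2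
  exact ⟨h2.1, lt_of_lt_of_le (by positivity) h1⟩
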